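/- For $n\ge 3$ and real numbers $h_1,\dots,h_n$ let $$H=\sum_{j=1}^n\bigl(\sigma^x_j\sigma^x_{j+1}+\sigma^y_j\sigma^y_{j+1}+\sigma^z_j\sigma^z_{j+1}+h_j\sigma^z_j\bigr)$$ be the Heisenberg Hamiltonian on a ring of $n$ qubits (site $n+1$ is site $1$; the $h_j$ are arbitrary, so in particular they may be any realisation of random fields). Let $H_1,\dots,H_L$ with $L=4n$ be its terms in the order $$\sigma_1^x\sigma_2^x,\dots,\sigma_n^x\sigma_1^x,\ \ \sigma_1^y\sigma_2^y,\dots,\sigma_n^y\sigma_1^y,\ \ \sigma_1^z\sigma_2^z,\dots,\sigma_n^z\sigma_1^z,\ \ h_1\sigma_1^z,\dots,h_n\sigma_n^z,$$ let $\|\cdot\|$ be the spectral norm and $\Lambda=\max_j\|H_j\|$. Let $p=1/(4-4^{1/3})$ and $$S_2(\lambda)=e^{\lambda H_1/2}\cdots e^{\lambda H_L/2}\,e^{\lambda H_L/2}\cdots e^{\lambda H_1/2},\qquad S_4(\lambda)=S_2(p\lambda)^2\,S_2((1-4p)\lambda)\,S_2(p\lambda)^2 .$$ (1) For all $n\ge3$,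 $h_1,\dots,h_n\in\mathbb R$, $t\in\mathbb R$ and integers $r\ge 1$, $$\bigl\|e^{-iHt}-S_4(-it/r)^r\bigr\|\le\Bigl(\frac{4p-1}{2}\Lambda|t|\Bigr)^5\frac{T_4(n)}{5!\,r^4}+2\,\frac{(20(4p-1)n\Lambda t)^6}{6!\,r^5}\exp\Bigl(\frac{20(4p-1)n\Lambda|t|}{r}\Bigr),$$ where $T_4(3)=23073564672$, $T_4(4)=94192316416$, $T_4(5)=278878851840$, and $$T_4(n)=1280000000n^4-7701760000n^3+23685120000n^2-30224677632n\qquad(n\ge6).$$ (2) Consequently the fourth-order formula has gate complexity $O(n^{3.4})$ for bounded fields, evolution time $O(n)$ and constant accuracy: for all real $h_{\max}$, $\tau$ and all $\varepsilon>0$ there is a constant $C$ such that for every $n\ge3$ there is an integer $1\le r\le Cn^{2.4}$ such that, whenever $|h_j|\le h_{\max}$ for all $j$ and $|t|\le\tau n$, we have $\|e^{-iHt}-S_4(-it/r)^r\|\le\varepsilon$, and $S_4(-it/r)^r$ is exactly the unitary of a circuit on the $n$ qubits with at most $Cn^{3.4}$ gates from the set consisting of CNOT, the Clifford gates Hadamard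 and $S=\mathrm{diag}(1,i)$, and $R_z(\theta)=e^{-i\sigma^z\theta/2}$ with $\theta\in\mathbb R$. -/

import Mathlib

open scoped Matrix.Norms.L2Operator

noncomputable section

namespace HeisenbergPF

/-! ### Qubits, Pauli operators and the Heisenberg ring -/

/-- Operators on `n` qubits, as matrices in the computational basis `{0,1}^n`.
The norm on them is the spectral norm (the `L²` operator norm). -/
abbrev Op (n : ℕ) : Type := Matrix (Fin n → Fin 2) (Fin n → Fin 2) ℂ

/-- The Pauli matrix `σˣ`. -/
def pauliX : Matrix (Fin 2) (Fin 2) ℂ := !![0, 1; 1, 0]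

/-- The Pauli matrix `σʸ`. -/
def pauliY : Matrix (Fin 2) (Fin 2) ℂ := !![0, -Complex.I; Complex.I, 0]

/-- The Pauli matrix `σᶻ`. -/
def pauliZ : Matrix (Fin 2) (Fin 2) ℂ := !![1, 0; 0, -1]

/-- The tensor product `A₁ ⊗ ⋯ ⊗ Aₙ` of single-qubit operators. -/
def tensor {n : ℕ} (A : Fin n → Matrix (Fin 2) (Fin 2) ℂ) : Op n :=
  Matrix.of fun s t => ∏ j, A j (s j) (t j)

/-- The single-qubit operator `A` acting on qubit `j` (and as the identity elsewhere). -/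
def onQubit {n : ℕ} (j : Fin n) (A : Matrix (Fin 2) (Fin 2) ℂ) : Op n :=
  tensor (Function.update (fun _ => 1) j A)

/-- The cyclic successor `j + 1` of a site on the ring (the last site is followed by the first). -/
def nextSite {n : ℕ} (j : Fin n) : Fin n :=
  ⟨(j.val + 1) % n, Nat.mod_lt _ (Nat.lt_of_le_of_lt (Nat.zero_le _) j.isLt)⟩

/-- The nearest-neighbour coupling `A_j A_{j+1}`. -/
def bond {n : ℕ} (A : Matrix (Fin 2) (Fin 2) ℂ) (j : Fin n) : Op n :=
  onQubit j A * onQubit (nextSite j) A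

/-- The periodic Heisenberg Hamiltonian `∑ⱼ (σ⃗ⱼ · σ⃗ⱼ₊₁ + hⱼ σⱼᶻ)`. -/
def hamiltonian {n : ℕ} (h : Fin n → ℝ) : Op n :=
  ∑ j, (bond pauliX j + bond pauliY j + bond pauliZ j + (h j : ℂ) • onQubit j pauliZ)

/-- The ordered list of the `4n` terms of the Hamiltonian: all `xx` couplings, then all `yy`
couplings, then all `zz` couplings, then all field terms, each family in the order `1, …, n`. -/
def terms {n : ℕ} (h : Fin n → ℝ) : List (Op n) :=
  List.ofFn (fun j => bond pauliX j) ++ List.ofFn (fun j => bond pauliY j) ++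
    List.ofFn (fun j => bond pauliZ j) ++ List.ofFn (fun j => (h j : ℂ) • onQubit j pauliZ)

/-- `Λ`, the largest spectral norm of a term in a list of operators. -/
def maxNorm {n : ℕ} (L : List (Op n)) : ℝ := (L.map fun A => ‖A‖).foldr max 0

/-! ### Suzuki product formulas -/

/-- The second-order formula
`S₂(z) = exp(z H₁/2) ⋯ exp(z H_L/2) exp(z H_L/2) ⋯ exp(z H₁/2)`. -/
def S2 {n : ℕ} (L : List (Op n)) (z : ℂ) : Op n :=
  (L.map fun A => NormedSpace.exp ((z / 2) • A)).prod *
    (L.reverse.map fun A => NormedSpace.exp ((z / 2) • A)).prod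

/-- Suzuki's coefficient `p = 1 / (4 - 4^{1/3})`. -/
def suzukiP : ℝ := 1 / (4 - (4 : ℝ) ^ (1 / 3 : ℝ))

/-- The fourth-order formula `S₄(z) = S₂(pz)² S₂((1 - 4p)z) S₂(pz)²`. -/
def S4 {n : ℕ} (L : List (Op n)) (z : ℂ) : Op n :=
  S2 L ((suzukiP : ℂ) * z) ^ 2 * S2 L ((1 - 4 * (suzukiP : ℂ)) * z) *
    S2 L ((suzukiP : ℂ) * z) ^ 2

/-- The coefficient `T₄(n)`; it is only used for `n ≥ 3`. -/
def T4 (n : ℕ) : ℝ :=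
  if n = 3 then 23073564672
  else if n = 4 then 94192316416
  else if n = 5 then 278878851840
  else 1280000000 * (n : ℝ) ^ 4 - 7701760000 * (n : ℝ) ^ 3 + 23685120000 * (n : ℝ) ^ 2
    - 30224677632 * (n : ℝ)

/-! ### Quantum circuits -/

/-- Elementary gates on `n` qubits: the single-qubit Clifford gates `H` and `S`, the rotations
`R_z(θ)` for real `θ`, and CNOT with control `c` and target `t`. -/
inductive Gate (n : ℕ) : Type
  | hadamard (j : Fin n) : Gate n
  | phase (j : Fin n) : Gate n
  | rz (θ : ℝ) (j : Fin n) : Gate n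
  | cnot (c t : Fin n) (hct : c ≠ t) : Gate n

/-- The unitary operator of a gate: `H = (σˣ + σᶻ)/√2`, `S = diag(1, i)`,
`R_z(θ) = exp(-i σᶻ θ/2)`, and `CNOT |s⟩ = |s'⟩`, where `s'` is `s` with the control bit
added (mod 2) to the target bit. -/
def Gate.toOp {n : ℕ} : Gate n → Op n
  | .hadamard j => onQubit j (((1 / Real.sqrt 2 : ℝ) : ℂ) • !![1, 1; 1, -1])
  | .phase j => onQubit j !![1, 0; 0, Complex.I]
  | .rz θ j => onQubit j
      !![Complex.exp (-(Complex.I * θ / 2)), 0; 0, Complex.exp (Complex.I * θ / 2)]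
  | .cnot c t _ => Matrix.of fun s' s => if s' = Function.update s t (s t + s c) then 1 else 0

/-- The unitary operator of a circuit, given as the list of its gates in the order in which
they are applied. The gate count of the circuit is the length of the list. -/
def circuitOp {n : ℕ} (g : List (Gate n)) : Op n := (g.reverse.map Gate.toOp).prod

end HeisenbergPF

end

/-! Every segment is a product of exponentials `exp (z B)` over the list `suzukiList`, so it is
compared with `exp (z H)` coefficient by coefficient as power series in `z`. Degrees 0 to 4 agree:
the list is a palindrome, so its series satisfies `f(X) f(-X) = 1`, which determines each even
coefficient from the lower ones, while Suzuki's `p` solves `4 p³ + (1 - 4p)³ = 0` and removes the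
cubic defect (`coeff_suzukiList`).

Degree 5 decides the power of `n`. By `majorizes_prodSer_sub` the difference of the two series is
majorized by `(K/2) X² exp (x X)`, where `x` is the sum of the norms of the exponents and `K` the
sum of the norms of their pairwise commutators. A term of the ring fails to commute with only
boundedly many others, so `K = O(n Λ²)` although `x` is of order `n Λ`. The fifth coefficient is
therefore `O(n⁴ Λ⁵)` rather than `O(n⁵ Λ⁵)`, with a constant small enough to lie below `T4`
(`pow_five_mul_le_T4`). From degree 6 on the two series are bounded separately, which gives the
factor 2 and the exponential (`norm_prod_exp_sub_exp_sum_le`). Unitarity makes the errors of the `r`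
segments add (`norm_pow_sub_pow_le`).

For the gate count, each exponential of a term is conjugated to a single `R_z` by at most 14 other
gates, so a segment costs `O(n)` gates. When `t = O(n)` the tail of order `n¹² / r⁵` dictates `r` of
order `n^(12/5)`; the fifth-order term alone would allow `n^(9/4)`. -/

/-! ### Exponential series with noncommuting coefficients -/

namespace HeisenbergPF

open PowerSeries Finset

/-! ### Coefficientwise majorants and sums of commutator norms. -/

section Majorants

variable {A : Type*} [NormedRing A]

/-- The real power series `F` majorizes the norms of the coefficients of `f`. -/
def Majorizes (F : PowerSeries ℝ) (f : PowerSeries A) : Prop :=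
  ∀ m, ‖coeff m f‖ ≤ coeff m F

theorem Majorizes.add {F G : PowerSeries ℝ} {f g : PowerSeries A} (hf : Majorizes F f)
    (hg : Majorizes G g) : Majorizes (F + G) (f + g) := fun m => by
  simpa using (norm_add_le _ _).trans (add_le_add (hf m) (hg m))

theorem Majorizes.mul {F G : PowerSeries ℝ} {f g : PowerSeries A} (hf : Majorizes F f)
    (hg : Majorizes G g) : Majorizes (F * G) (f * g) := fun m => by
  rw [coeff_mul, coeff_mul]
  refine (norm_sum_le _ _).trans (sum_le_sum fun ij _ => (norm_mul_le _ _).trans ?_)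
  exact mul_le_mul (hf _) (hg _) (norm_nonneg _) ((norm_nonneg _).trans (hf _))

theorem Majorizes.mono {F G : PowerSeries ℝ} {f : PowerSeries A} (hf : Majorizes F f)
    (h : ∀ m, coeff m F ≤ coeff m G) : Majorizes G f := fun m => (hf m).trans (h m)

/-- The real exponential series `exp (x X)`. -/
noncomputable def realExp (x : ℝ) : PowerSeries ℝ := rescale x (PowerSeries.exp ℝ)

theorem coeff_realExp (x : ℝ) (m : ℕ) : coeff m (realExp x) = x ^ m / m.factorial := by
  simp [realExp, coeff_rescale, coeff_exp, div_eq_mul_inv]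

theorem realExp_mul (x y : ℝ) : realExp x * realExp y = realExp (x + y) :=
  exp_mul_exp_eq_exp_add x y

theorem coeff_realExp_mono {x y : ℝ} (hx : 0 ≤ x) (hxy : x ≤ y) (m : ℕ) :
    coeff m (realExp x) ≤ coeff m (realExp y) := by
  rw [coeff_realExp, coeff_realExp]
  gcongr

/-- The sum of the norms of the members of a list. -/
noncomputable def normSum (l : List A) : ℝ := (l.map fun B => ‖B‖).sum

@[simp] theorem normSum_nil : normSum ([] : List A) = 0 := rfl

@[simp] theorem normSum_cons (B : A) (l : List A) : normSum (B :: l) = ‖B‖ + normSum l := by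
  simp [normSum]

theorem normSum_nonneg (l : List A) : 0 ≤ normSum l := by
  induction l with
  | nil => simp
  | cons B l ih => simpa using add_nonneg (norm_nonneg B) ih

theorem norm_sum_le_normSum (l : List A) : ‖l.sum‖ ≤ normSum l := by
  induction l with
  | nil => simp
  | cons B l ih => simpa using (norm_add_le _ _).trans (add_le_add le_rfl ih)

/-- The sum of the norms of the commutators of the pairs of members of a list. -/
noncomputable def commSum : List A → ℝ
  | [] => 0
  | X :: l => (l.map fun Y => ‖X * Y - Y * X‖).sum + commSum l

theorem commSum_nonneg (l : List A) : 0 ≤ commSum l := by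
  induction l with
  | nil => simp [commSum]
  | cons X l ih =>
    exact add_nonneg (List.sum_nonneg (by simp only [List.mem_map]; rintro _ ⟨Y, -, rfl⟩; positivity)) ih

theorem norm_commutator_sum_le (X : A) (l : List A) :
    ‖X * l.sum - l.sum * X‖ ≤ (l.map fun Y => ‖X * Y - Y * X‖).sum := by
  induction l with
  | nil => simp
  | cons Y l ih =>
    have e : X * (Y + l.sum) - (Y + l.sum) * X
        = (X * Y - Y * X) + (X * l.sum - l.sum * X) := by noncomm_ring
    simp only [List.sum_cons, List.map_cons]
    rw [e]
    exact (norm_add_le _ _).trans (add_le_add le_rfl ih)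

/-- Leibniz rule: carrying `Y` through the `k` factors one at a time produces `k` terms, each with
one commutator and `k - 1` factors `X`. -/
theorem norm_commutator_pow_le [NormOneClass A] (X Y : A) (k : ℕ) :
    ‖X ^ k * Y - Y * X ^ k‖ ≤ k * ‖X‖ ^ (k - 1) * ‖X * Y - Y * X‖ := by
  induction k with
  | zero => simp
  | succ k ih =>
    have e : X ^ (k + 1) * Y - Y * X ^ (k + 1)
        = X * (X ^ k * Y - Y * X ^ k) + (X * Y - Y * X) * X ^ k := by
      rw [pow_succ']; noncomm_ring
    rw [e]
    have h2 : ‖(X * Y - Y * X) * X ^ k‖ ≤ ‖X * Y - Y * X‖ * ‖X‖ ^ k :=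
      (norm_mul_le _ _).trans (by gcongr; exact norm_pow_le X k)
    have h1 : ‖X * (X ^ k * Y - Y * X ^ k)‖ ≤ k * ‖X‖ ^ k * ‖X * Y - Y * X‖ := by
      refine (norm_mul_le _ _).trans ((mul_le_mul_of_nonneg_left ih (norm_nonneg _)).trans ?_)
      rcases k with _ | k
      · simp
      · simp only [Nat.add_sub_cancel, pow_succ]
        apply le_of_eq; ring
    refine (norm_add_le _ _).trans ((add_le_add h1 h2).trans (le_of_eq ?_))
    push_cast
    ring

end Majorants

variable {A : Type*} [NormedRing A] [NormedAlgebra ℂ A]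

/-- The series `exp (B X)`. -/
noncomputable def expSer (B : A) : PowerSeries A := .mk fun m => ((m.factorial : ℂ)⁻¹) • B ^ m

@[simp]
theorem coeff_expSer (B : A) (m : ℕ) :
    coeff m (expSer B) = ((m.factorial : ℂ)⁻¹) • B ^ m := by
  simp [expSer]

@[simp]
theorem constantCoeff_expSer (B : A) : constantCoeff (expSer B) = 1 := by
  rw [← coeff_zero_eq_constantCoeff_apply, coeff_expSer]
  simp

theorem expSer_mul_neg (B : A) : expSer B * expSer (-B) = 1 := by
  ext m
  have h : (B + -B) ^ m = ∑ ij ∈ antidiagonal m, m.choose ij.1 • (B ^ ij.1 * (-B) ^ ij.2) :=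
    ((Commute.refl B).neg_right).add_pow' m
  have h2 : ((m.factorial : ℂ)⁻¹) • (B + -B) ^ m = coeff m (expSer B * expSer (-B)) := by
    rw [h, coeff_mul, smul_sum]
    refine sum_congr rfl fun ij hij => ?_
    rw [HasAntidiagonal.mem_antidiagonal] at hij
    subst hij
    rw [coeff_expSer, coeff_expSer, smul_mul_smul_comm, ← Nat.cast_smul_eq_nsmul ℂ, smul_smul,
      Nat.cast_add_choose]
    congr 1
    have := Nat.cast_ne_zero (R := ℂ).2 (Nat.factorial_ne_zero (ij.1 + ij.2))
    field_simp
  rw [← h2, add_neg_cancel, coeff_one]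
  rcases m with _ | m <;> simp

theorem majorizes_expSer [NormOneClass A] (B : A) : Majorizes (realExp ‖B‖) (expSer B) :=
  fun m => by
  rw [coeff_realExp, coeff_expSer, norm_smul, div_eq_inv_mul, norm_inv, Complex.norm_natCast]
  gcongr
  exact norm_pow_le B m

/-- The product of the series `exp (B X)` over a list of elements `B`. -/
noncomputable def prodSer (l : List A) : PowerSeries A := (l.map expSer).prod

@[simp] theorem prodSer_nil : prodSer ([] : List A) = 1 := rfl

@[simp] theorem prodSer_cons (B : A) (l : List A) :
    prodSer (B :: l) = expSer B * prodSer l := by simp [prodSer]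

theorem prodSer_append (l l' : List A) : prodSer (l ++ l') = prodSer l * prodSer l' := by
  simp [prodSer]

theorem majorizes_prodSer [NormOneClass A] (l : List A) :
    Majorizes (realExp (normSum l)) (prodSer l) := by
  induction l with
  | nil =>
    intro m
    rw [coeff_realExp]
    rcases m with _ | m <;> simp [coeff_one]
  | cons B l ih =>
    rw [prodSer_cons, normSum_cons, ← realExp_mul]
    exact (majorizes_expSer B).mul ih

/-! ### Commutator bound for the coefficients -/

/-- Coefficient form of the differential equation `F' = X F + F Y` for `F(t) = exp (tX) exp (tY)`.
-/
theorem coeff_succ_expSer_mul_expSer (X Y : A) (m : ℕ) :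
    ((m + 1 : ℕ) : ℂ) • coeff (m + 1) (expSer X * expSer Y)
      = X * coeff m (expSer X * expSer Y) + coeff m (expSer X * expSer Y) * Y := by
  have key : ∀ (f : ℕ → ℕ → A), ((m + 1 : ℕ) : ℂ) • ∑ ij ∈ antidiagonal (m + 1), f ij.1 ij.2
      = ∑ ij ∈ antidiagonal m, ((ij.1 + 1 : ℕ) : ℂ) • f (ij.1 + 1) ij.2
        + ∑ ij ∈ antidiagonal m, ((ij.2 + 1 : ℕ) : ℂ) • f ij.1 (ij.2 + 1) := by
    intro f
    have e : ((m + 1 : ℕ) : ℂ) • ∑ ij ∈ antidiagonal (m + 1), f ij.1 ij.2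
        = ∑ ij ∈ antidiagonal (m + 1), (ij.1 : ℂ) • f ij.1 ij.2
          + ∑ ij ∈ antidiagonal (m + 1), (ij.2 : ℂ) • f ij.1 ij.2 := by
      rw [smul_sum, ← sum_add_distrib]
      refine sum_congr rfl fun ij hij => ?_
      rw [HasAntidiagonal.mem_antidiagonal] at hij
      rw [← hij, Nat.cast_add, add_smul]
    rw [e, Nat.sum_antidiagonal_succ (f := fun ij => (ij.1 : ℂ) • f ij.1 ij.2),
      Nat.sum_antidiagonal_succ' (f := fun ij => (ij.2 : ℂ) • f ij.1 ij.2)]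
    simp
  have fac : ∀ (Z : A) (k : ℕ), ((k + 1 : ℕ) : ℂ) • coeff (k + 1) (expSer Z)
      = ((k.factorial : ℂ)⁻¹) • Z ^ (k + 1) := by
    intro Z k
    rw [coeff_expSer, smul_smul, Nat.factorial_succ]
    congr 1
    have := Nat.cast_ne_zero (R := ℂ).2 (Nat.factorial_ne_zero k)
    have h' := Nat.cast_ne_zero (R := ℂ).2 (Nat.succ_ne_zero k)
    push_cast at h' ⊢
    field_simp
  rw [coeff_mul, coeff_mul, key fun i j => coeff i (expSer X) * coeff j (expSer Y), mul_sum,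
    sum_mul]
  congr 1 <;> refine sum_congr rfl fun ij _ => ?_
  · rw [← smul_mul_assoc, fac, pow_succ', coeff_expSer X ij.1, ← mul_assoc, mul_smul_comm]
  · rw [← mul_smul_comm, fac, pow_succ, coeff_expSer Y ij.2, mul_assoc, smul_mul_assoc]

/-- Only the powers of `X` contribute to the commutator with `Y`. The factor `k` from
`norm_commutator_pow_le` turns `1/k!` into `1/(k-1)!`, so the bound is the coefficient of a full
exponential, shifted by one degree. -/
theorem norm_coeff_commutator_le [NormOneClass A] (X Y : A) (m : ℕ) :
    ‖coeff (m + 1) (expSer X * expSer Y) * Y - Y * coeff (m + 1) (expSer X * expSer Y)‖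
      ≤ ‖X * Y - Y * X‖ * ((‖X‖ + ‖Y‖) ^ m / m.factorial) := by
  rw [← coeff_realExp, ← realExp_mul, coeff_mul, coeff_mul, sum_mul, mul_sum, ← sum_sub_distrib,
    Nat.sum_antidiagonal_succ, mul_sum]
  have h0 : coeff 0 (expSer X) * coeff (m + 1) (expSer Y) * Y
      - Y * (coeff 0 (expSer X) * coeff (m + 1) (expSer Y)) = 0 := by
    simp only [coeff_expSer, pow_zero, Nat.factorial_zero, Nat.cast_one, inv_one, one_smul,
      one_mul, smul_mul_assoc, mul_smul_comm, ← pow_succ, ← pow_succ', sub_self]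
  rw [h0, zero_add]
  refine (norm_sum_le _ _).trans (sum_le_sum fun ij _ => ?_)
  have e : coeff (ij.1 + 1) (expSer X) * coeff ij.2 (expSer Y) * Y
      - Y * (coeff (ij.1 + 1) (expSer X) * coeff ij.2 (expSer Y))
      = (((ij.1 + 1).factorial : ℂ)⁻¹) • ((X ^ (ij.1 + 1) * Y - Y * X ^ (ij.1 + 1))
        * coeff ij.2 (expSer Y)) := by
    simp only [coeff_expSer, smul_mul_assoc, mul_smul_comm, sub_mul, smul_sub, mul_assoc,
      ← pow_succ, ← pow_succ', smul_comm ((ij.2.factorial : ℂ)⁻¹)]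
  rw [e, norm_smul, norm_inv, Complex.norm_natCast]
  have h1 := norm_commutator_pow_le X Y (ij.1 + 1)
  have h2 := majorizes_expSer Y ij.2
  rw [Nat.add_sub_cancel] at h1
  refine (mul_le_mul_of_nonneg_left ((norm_mul_le _ _).trans (mul_le_mul h1 h2 (norm_nonneg _)
    (by positivity))) (by positivity)).trans (le_of_eq ?_)
  rw [coeff_realExp ‖X‖, Nat.factorial_succ]
  push_cast
  field_simp

/-- The second-order remainder `K X² exp (x X) / 2`. -/
noncomputable def commSer (K x : ℝ) : PowerSeries ℝ := C (K / 2) * PowerSeries.X ^ 2 * realExp x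

theorem coeff_commSer_add_two (K x : ℝ) (m : ℕ) :
    coeff (m + 2) (commSer K x) = K / 2 * (x ^ m / m.factorial) := by
  rw [commSer, mul_assoc, coeff_C_mul, coeff_X_pow_mul, coeff_realExp]

theorem coeff_commSer_nonneg {K x : ℝ} (hK : 0 ≤ K) (hx : 0 ≤ x) (m : ℕ) :
    0 ≤ coeff m (commSer K x) := by
  rcases m with _ | _ | m
  · simp [commSer]
  · rw [commSer, mul_assoc, coeff_C_mul, coeff_X_pow_mul']
    simp
  · rw [coeff_commSer_add_two]
    positivity

theorem commSer_mono {K K' x x' : ℝ} (hK : 0 ≤ K) (hx : 0 ≤ x) (hKK : K ≤ K') (hxx : x ≤ x')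
    (m : ℕ) : coeff m (commSer K x) ≤ coeff m (commSer K' x') := by
  rcases m with _ | _ | m
  · simp [commSer]
  · rw [commSer, commSer, mul_assoc, mul_assoc, coeff_C_mul, coeff_C_mul, coeff_X_pow_mul',
      coeff_X_pow_mul']
    simp
  · rw [coeff_commSer_add_two, coeff_commSer_add_two]
    have := hK.trans hKK
    gcongr

/-- With `F = exp (tX) exp (tY)`, the difference `D = F - exp (t(X+Y))` solves `D' = (X+Y) D + [F,
Y]`. The commutator is majorized by `K t exp (x t)`, and the scalar equation `d' = x d + K t exp (x
t)`, `d(0) = 0`, has the solution `(K/2) t² exp (x t)`. -/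
theorem majorizes_expSer_mul_sub [NormOneClass A] (X Y : A) :
    Majorizes (commSer ‖X * Y - Y * X‖ (‖X‖ + ‖Y‖)) (expSer X * expSer Y - expSer (X + Y)) := by
  have h0 : coeff 0 (expSer X * expSer Y - expSer (X + Y)) = 0 := by
    simp
  have h1 : coeff 1 (expSer X * expSer Y - expSer (X + Y)) = 0 := by
    simp [coeff_mul, Nat.sum_antidiagonal_succ, coeff_expSer, -coeff_zero_eq_constantCoeff]
    abel
  have rec_ : ∀ m, ((m + 1 : ℕ) : ℂ) • coeff (m + 1) (expSer X * expSer Y - expSer (X + Y))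
      = (X + Y) * coeff m (expSer X * expSer Y - expSer (X + Y))
        + (coeff m (expSer X * expSer Y) * Y - Y * coeff m (expSer X * expSer Y)) := by
    intro m
    have hE : ((m + 1 : ℕ) : ℂ) • coeff (m + 1) (expSer (X + Y))
        = (X + Y) * coeff m (expSer (X + Y)) := by
      rw [coeff_expSer, smul_smul, coeff_expSer, mul_smul_comm, ← pow_succ', Nat.factorial_succ]
      congr 1
      have := Nat.cast_ne_zero (R := ℂ).2 (Nat.factorial_ne_zero m)
      have h' := Nat.cast_ne_zero (R := ℂ).2 (Nat.succ_ne_zero m)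
      push_cast at h' ⊢
      field_simp
    rw [map_sub, smul_sub, coeff_succ_expSer_mul_expSer, hE, map_sub]
    noncomm_ring
  intro m
  rcases m with _ | m
  · rw [h0, norm_zero]
    exact coeff_commSer_nonneg (norm_nonneg _) (by positivity) _
  induction m with
  | zero =>
    rw [zero_add, h1, norm_zero]
    exact coeff_commSer_nonneg (norm_nonneg _) (by positivity) _
  | succ m ih =>
    have hr := congrArg norm (rec_ (m + 1))
    rw [norm_smul, Complex.norm_natCast] at hr
    have hc := norm_coeff_commutator_le X Y m
    have hs : ‖X + Y‖ ≤ ‖X‖ + ‖Y‖ := norm_add_le _ _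
    have hb : ((m + 1 + 1 : ℕ) : ℝ)
        * ‖coeff (m + 1 + 1) (expSer X * expSer Y - expSer (X + Y))‖
        ≤ (‖X‖ + ‖Y‖) * coeff (m + 1) (commSer ‖X * Y - Y * X‖ (‖X‖ + ‖Y‖))
          + ‖X * Y - Y * X‖ * ((‖X‖ + ‖Y‖) ^ m / m.factorial) := by
      rw [hr]
      refine (norm_add_le _ _).trans (add_le_add ((norm_mul_le _ _).trans ?_) hc)
      exact mul_le_mul hs ih (norm_nonneg _) (by positivity)
    have hpos : (0 : ℝ) < ((m + 1 + 1 : ℕ) : ℝ) := by positivity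
    refine le_of_mul_le_mul_left (hb.trans (le_of_eq ?_)) hpos
    rw [coeff_commSer_add_two]
    -- The scalar recursion holds with equality; degree 2 is separate because it refers to the
    -- coefficient of degree 1, which vanishes.
    rcases m with _ | m
    · rw [zero_add, commSer, mul_assoc, coeff_C_mul, coeff_X_pow_mul']
      simp
      ring
    · rw [coeff_commSer_add_two, Nat.factorial_succ]
      push_cast
      field_simp
      ring

theorem realExp_mul_commSer (a K x : ℝ) : realExp a * commSer K x = commSer K (a + x) := by
  rw [commSer, commSer, ← realExp_mul]
  ring

theorem commSer_add (K K' x : ℝ) : commSer K x + commSer K' x = commSer (K + K') x := by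
  rw [commSer, commSer, commSer, add_div, map_add]
  ring

/-- Merging the head with the already merged tail costs the commutator of the head with the sum of
the tail, at most the sum of its commutators with the members; over the induction these add up to
`commSum`. -/
theorem majorizes_prodSer_sub [NormOneClass A] (l : List A) :
    Majorizes (commSer (commSum l) (normSum l)) (prodSer l - expSer l.sum) := by
  induction l with
  | nil =>
    have : prodSer ([] : List A) - expSer ([] : List A).sum = 0 := by
      ext m
      rcases m with _ | m <;> simp [coeff_one]
    rw [this]
    intro m
    simpa using coeff_commSer_nonneg (commSum_nonneg ([] : List A)) (le_refl 0) m
  | cons B l ih =>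
    have e : prodSer (B :: l) - expSer (B :: l).sum
        = (expSer B * expSer l.sum - expSer (B + l.sum))
          + expSer B * (prodSer l - expSer l.sum) := by
      rw [prodSer_cons, List.sum_cons]
      noncomm_ring
    rw [e, normSum_cons, commSum, ← commSer_add, ← realExp_mul_commSer ‖B‖ (commSum l)]
    refine Majorizes.add ((majorizes_expSer_mul_sub B l.sum).mono ?_)
      ((majorizes_expSer B).mul ih)
    exact commSer_mono (norm_nonneg _) (by positivity) (norm_commutator_sum_le B l)
      (add_le_add le_rfl (norm_sum_le_normSum l))

end HeisenbergPF

namespace HeisenbergPF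

open PowerSeries Finset NormedSpace

/-! ### Evaluation of the series and the error of a product of exponentials. -/

section Evaluation

variable {A : Type*} [NormedRing A] [NormedAlgebra ℂ A]

theorem summable_norm_of_majorizes {f : PowerSeries A} {x : ℝ} (hf : Majorizes (realExp x) f)
    (z : ℂ) : Summable fun m => ‖z ^ m • coeff m f‖ := by
  refine Summable.of_nonneg_of_le (fun m => norm_nonneg _) (fun m => ?_)
    (Real.summable_pow_div_factorial (‖z‖ * x))
  rw [norm_smul, norm_pow, mul_pow, mul_div_assoc, ← coeff_realExp]
  exact mul_le_mul_of_nonneg_left (hf m) (by positivity)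

theorem hasSum_expSer [CompleteSpace A] (B : A) (z : ℂ) :
    HasSum (fun m => z ^ m • coeff m (expSer B)) (exp (z • B)) := by
  have h := exp_series_hasSum_exp' (𝕂 := ℂ) (z • B)
  refine h.congr_fun fun m => ?_
  rw [coeff_expSer, smul_pow, smul_comm]

theorem hasSum_prodSer [NormOneClass A] [CompleteSpace A] (l : List A) (z : ℂ) :
    HasSum (fun m => z ^ m • coeff m (prodSer l)) (l.map fun B => exp (z • B)).prod := by
  induction l with
  | nil =>
    convert! hasSum_ite_eq 0 (1 : A) using 2 with m
    rcases m with _ | m <;> simp [coeff_one]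
  | cons B l ih =>
    have h1 := summable_norm_of_majorizes (majorizes_expSer B) z
    have h2 := summable_norm_of_majorizes (majorizes_prodSer l) z
    have h3 := tsum_mul_tsum_eq_tsum_sum_antidiagonal_of_summable_norm h1 h2
    have h4 := (summable_norm_sum_mul_antidiagonal_of_summable_norm h1 h2).of_norm.hasSum
    rw [← h3, (hasSum_expSer B z).tsum_eq, ih.tsum_eq] at h4
    rw [List.map_cons, List.prod_cons]
    refine h4.congr_fun fun m => ?_
    rw [prodSer_cons, coeff_mul, smul_sum]
    refine sum_congr rfl fun ij hij => ?_
    rw [HasAntidiagonal.mem_antidiagonal] at hij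
    rw [smul_mul_smul_comm, ← pow_add, hij]

theorem exp_tail_term_le {x : ℝ} (hx : 0 ≤ x) (k m : ℕ) :
    x ^ (m + k) / (m + k).factorial ≤ x ^ k / k.factorial * (x ^ m / m.factorial) := by
  rw [div_mul_div_comm, ← pow_add, add_comm k m]
  have h : (k.factorial * m.factorial : ℝ) ≤ (m + k).factorial := by
    rw [mul_comm]
    exact_mod_cast Nat.le_of_dvd (Nat.factorial_pos _) (Nat.factorial_mul_factorial_dvd_factorial_add m k)
  gcongr

/-- The commutator majorant is spent on degree 5 only, where `K/2 · x³/3!` gives the `1/12`; higher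
degrees use the plain exponential majorant of each series. -/
theorem norm_prod_exp_sub_exp_sum_le [NormOneClass A] [CompleteSpace A] (l : List A)
    (h : ∀ m ≤ 4, coeff m (prodSer l) = coeff m (expSer l.sum)) (z : ℂ) {x : ℝ}
    (hx : normSum l ≤ x) :
    ‖(l.map fun B => exp (z • B)).prod - exp (z • l.sum)‖
      ≤ ‖z‖ ^ 5 * (commSum l / 12 * normSum l ^ 3)
        + 2 * ((‖z‖ * x) ^ 6 / (Nat.factorial 6 : ℝ) * Real.exp (‖z‖ * x)) := by
  have hx0 : 0 ≤ x := (normSum_nonneg l).trans hx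
  set f := prodSer l - expSer l.sum with hf
  have hs : HasSum (fun m => z ^ m • coeff m f)
      ((l.map fun B => exp (z • B)).prod - exp (z • l.sum)) := by
    refine ((hasSum_prodSer l z).sub (hasSum_expSer l.sum z)).congr_fun fun m => ?_
    rw [hf, map_sub, smul_sub]
  have hsplit := hs.summable.sum_add_tsum_nat_add 6
  rw [hs.tsum_eq] at hsplit
  have h04 : ∀ m ≤ 4, coeff m f = 0 := fun m hm => by rw [hf, map_sub, h m hm, sub_self]
  have hlow : ∑ m ∈ range 6, z ^ m • coeff m f = z ^ 5 • coeff 5 f := by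
    simp only [sum_range_succ, range_zero, sum_empty]
    rw [h04 0 (by norm_num), h04 1 (by norm_num), h04 2 (by norm_num), h04 3 (by norm_num),
      h04 4 (by norm_num)]
    simp
  rw [hlow] at hsplit
  rw [← hsplit]
  have h5 : ‖z ^ 5 • coeff 5 f‖ ≤ ‖z‖ ^ 5 * (commSum l / 12 * normSum l ^ 3) := by
    rw [norm_smul, norm_pow]
    refine mul_le_mul_of_nonneg_left ((majorizes_prodSer_sub l 5).trans (le_of_eq ?_))
      (by positivity)
    rw [show (5 : ℕ) = 3 + 2 from rfl, coeff_commSer_add_two]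
    simp [Nat.factorial]
    ring
  refine (norm_add_le _ _).trans (add_le_add h5 ?_)
  have hexp : HasSum (fun m : ℕ => 2 * ((‖z‖ * x) ^ 6 / (Nat.factorial 6 : ℝ)
      * ((‖z‖ * x) ^ m / m.factorial)))
      (2 * ((‖z‖ * x) ^ 6 / (Nat.factorial 6 : ℝ) * Real.exp (‖z‖ * x))) := by
    rw [Real.exp_eq_exp_ℝ]
    exact ((expSeries_div_hasSum_exp (‖z‖ * x)).mul_left _).mul_left _
  refine tsum_of_norm_bounded hexp fun m => ?_
  have hxz : 0 ≤ ‖z‖ * x := by positivity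
  refine le_trans ?_ (mul_le_mul_of_nonneg_left (exp_tail_term_le hxz 6 m) zero_le_two)
  rw [norm_smul, norm_pow, hf, map_sub, mul_pow, mul_div_assoc, ← coeff_realExp, two_mul,
    ← mul_add]
  refine mul_le_mul_of_nonneg_left ((norm_sub_le _ _).trans (add_le_add ?_ ?_)) (by positivity)
  · exact (majorizes_prodSer l _).trans (coeff_realExp_mono (normSum_nonneg l) hx _)
  · exact (majorizes_expSer _ _).trans
      (coeff_realExp_mono (norm_nonneg _) ((norm_sum_le_normSum l).trans hx) _)

end Evaluation

/-! ### Order conditions -/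

section Order

variable {A : Type*} [NormedRing A] [NormedAlgebra ℂ A]

theorem coeff_prodSer_smul (c : ℂ) (l : List A) (m : ℕ) :
    coeff m (prodSer (l.map fun B => c • B)) = c ^ m • coeff m (prodSer l) := by
  induction l generalizing m with
  | nil => rcases m with _ | m <;> simp [coeff_one]
  | cons B l ih =>
    rw [List.map_cons, prodSer_cons, prodSer_cons, coeff_mul, coeff_mul, smul_sum]
    refine sum_congr rfl fun ij hij => ?_
    rw [HasAntidiagonal.mem_antidiagonal] at hij
    rw [ih, coeff_expSer, coeff_expSer, smul_pow, ← hij, pow_add, ← smul_mul_smul_comm, smul_comm]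

/-- The inverse of an ordered product is the reversed product of the inverses. -/
theorem prodSer_mul_reverse_neg (l : List A) :
    prodSer l * prodSer (l.reverse.map fun B => (-1 : ℂ) • B) = 1 := by
  induction l with
  | nil => simp
  | cons B l ih =>
    rw [List.reverse_cons, List.map_append, prodSer_append, prodSer_cons, mul_assoc,
      ← mul_assoc (prodSer l), ih, one_mul]
    simp [expSer_mul_neg]

theorem coeff_zero_prodSer (l : List A) : coeff 0 (prodSer l) = 1 := by
  induction l with
  | nil => simp
  | cons B l ih => simp_all

theorem coeff_one_prodSer (l : List A) : coeff 1 (prodSer l) = l.sum := by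
  induction l with
  | nil => simp [coeff_one]
  | cons B l ih =>
    rw [prodSer_cons, coeff_mul, Nat.sum_antidiagonal_succ]
    simp [coeff_zero_prodSer, ih, -coeff_zero_eq_constantCoeff, add_comm]

theorem sum_antidiagonal_palindrome {l : List A} (hl : l.reverse = l) (m : ℕ) (hm : m ≠ 0) :
    ∑ ij ∈ antidiagonal m, (-1 : ℂ) ^ ij.2 • (coeff ij.1 (prodSer l) * coeff ij.2 (prodSer l))
      = 0 := by
  have h := congrArg (coeff m) (prodSer_mul_reverse_neg l)
  rw [hl, coeff_mul, coeff_one, if_neg hm] at h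
  rw [← h]
  refine sum_congr rfl fun ij _ => ?_
  rw [coeff_prodSer_smul, mul_smul_comm]

theorem coeff_two_palindrome {l : List A} (hl : l.reverse = l) :
    coeff 2 (prodSer l) = (2 : ℂ)⁻¹ • l.sum ^ 2 := by
  have h := sum_antidiagonal_palindrome hl 2 two_ne_zero
  simp only [Nat.antidiagonal_succ, Nat.antidiagonal_zero, map_singleton, map_cons, sum_cons, sum_singleton,
    Function.Embedding.prodMap, Function.Embedding.coeFn_mk, Prod.map, Function.Embedding.refl_apply,
    coeff_zero_prodSer, coeff_one_prodSer, zero_add, Nat.succ_eq_add_one, one_mul, mul_one,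
    Nat.reduceAdd] at h
  rw [eq_inv_smul_iff₀ two_ne_zero, ← sub_eq_zero, ← h, two_smul, pow_two]
  simp
  abel

/-- In degree 4, `f(X) f(-X) = 1` reads `2 c₄ = c₁ c₃ + c₃ c₁ - c₂²`, and `1/3 - 1/4 = 1/12`. -/
theorem coeff_four_palindrome {l : List A} (hl : l.reverse = l)
    (h3 : coeff 3 (prodSer l) = (6 : ℂ)⁻¹ • l.sum ^ 3) :
    coeff 4 (prodSer l) = (24 : ℂ)⁻¹ • l.sum ^ 4 := by
  have h := sum_antidiagonal_palindrome hl 4 four_ne_zero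
  have h2 := coeff_two_palindrome hl
  simp only [Nat.antidiagonal_succ, Nat.antidiagonal_zero, map_singleton, map_cons, sum_cons, sum_singleton,
    Function.Embedding.prodMap, Function.Embedding.coeFn_mk, Prod.map, Function.Embedding.refl_apply,
    coeff_zero_prodSer, coeff_one_prodSer, zero_add, Nat.succ_eq_add_one, one_mul, mul_one,
    Nat.reduceAdd, h2, h3, smul_mul_assoc, mul_smul_comm, ← pow_succ, ← pow_succ', ← pow_add] at h
  have h' : (2 : ℂ) • coeff 4 (prodSer l) - (12 : ℂ)⁻¹ • l.sum ^ 4 = 0 := by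
    rw [← h]
    module
  rw [sub_eq_zero] at h'
  rw [← eq_inv_smul_iff₀ two_ne_zero] at h'
  rw [h', smul_smul]
  norm_num

theorem coeff_eq_of_palindrome {l : List A} (hl : l.reverse = l)
    (h3 : coeff 3 (prodSer l) = (6 : ℂ)⁻¹ • l.sum ^ 3) (m : ℕ) (hm : m ≤ 4) :
    coeff m (prodSer l) = coeff m (expSer l.sum) := by
  rw [coeff_expSer]
  interval_cases m
  · simpa using coeff_zero_prodSer l
  · simpa using coeff_one_prodSer l
  · simpa using coeff_two_palindrome hl
  · simpa [Nat.factorial] using h3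
  · simpa [Nat.factorial] using coeff_four_palindrome hl h3

/-- The series `f` agrees with `exp (F X) + D X³` up to third order. -/
structure CubicApprox (f : PowerSeries A) (F D : A) : Prop where
  zero : coeff 0 f = 1
  one : coeff 1 f = F
  two : coeff 2 f = (2 : ℂ)⁻¹ • F ^ 2
  three : coeff 3 f = (6 : ℂ)⁻¹ • F ^ 3 + D

/-- Both factors approximate exponentials of multiples of the same `H`, which commute; the cubic
defects meet only the constant coefficient 1 of the other factor, so they add. -/
theorem CubicApprox.mul {f g : PowerSeries A} {H D D' : A} {a b : ℂ}
    (hf : CubicApprox f (a • H) D) (hg : CubicApprox g (b • H) D') :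
    CubicApprox (f * g) ((a + b) • H) (D + D') := by
  constructor <;> rw [coeff_mul] <;>
  simp only [Nat.antidiagonal_succ, Nat.antidiagonal_zero, map_singleton, map_cons, sum_cons, sum_singleton,
    Function.Embedding.prodMap, Function.Embedding.coeFn_mk, Prod.map, Function.Embedding.refl_apply,
    hf.zero, hf.one, hf.two, hf.three, hg.zero, hg.one, hg.two, hg.three,
    zero_add, Nat.succ_eq_add_one, one_mul, mul_one,
    Nat.reduceAdd, smul_mul_assoc, mul_smul_comm, smul_pow, ← pow_succ, ← pow_succ', ← pow_two]
  · simp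
  · module
  · module
  · module

/-- The list of exponents of the second-order formula with coefficient `a`. -/
noncomputable def symList (L : List A) (a : ℂ) : List A := (L ++ L.reverse).map fun B => (a / 2) • B

/-- One `D` serves all `a`: changing `a` rescales the variable, so the cubic defect scales as `a³`.
This reduces the fourth-order condition to a scalar equation for `p`. -/
theorem cubicApprox_symList (L : List A) : ∃ D : A, ∀ a : ℂ,
    CubicApprox (prodSer (symList L a)) (a • L.sum) (a ^ 3 • D) := by
  set l := (L ++ L.reverse).map fun B => (1 / 2 : ℂ) • B with hl
  have hrev : l.reverse = l := by simp [hl]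
  have hsum : l.sum = L.sum := by
    rw [hl, ← List.smul_sum, List.sum_append, List.sum_reverse, smul_add, ← add_smul]
    norm_num
  have hsym : ∀ a, symList L a = l.map fun B => a • B := by
    intro a
    rw [symList, hl, List.map_map]
    refine List.map_congr_left fun B _ => ?_
    simp [smul_smul, div_eq_mul_inv]
  refine ⟨coeff 3 (prodSer l) - (6 : ℂ)⁻¹ • L.sum ^ 3, fun a => ⟨?_, ?_, ?_, ?_⟩⟩
  · exact coeff_zero_prodSer _
  · rw [hsym, coeff_prodSer_smul, coeff_one_prodSer, hsum, pow_one]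
  · rw [hsym, coeff_prodSer_smul, coeff_two_palindrome hrev, hsum, smul_pow, smul_comm]
  · rw [hsym, coeff_prodSer_smul, smul_pow]
    module

/-- The list of exponents of the fourth-order formula with coefficient `p`. -/
noncomputable def suzukiList (L : List A) (p : ℂ) : List A :=
  symList L p ++ symList L p ++ symList L (1 - 4 * p) ++ symList L p ++ symList L p

theorem suzukiList_reverse (L : List A) (p : ℂ) : (suzukiList L p).reverse = suzukiList L p := by
  simp [suzukiList, symList]

theorem sum_suzukiList (L : List A) (p : ℂ) : (suzukiList L p).sum = L.sum := by
  simp only [suzukiList, symList, List.sum_append, ← List.smul_sum, List.sum_reverse]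
  module

theorem coeff_suzukiList (L : List A) {p : ℂ} (hp : 4 * p ^ 3 + (1 - 4 * p) ^ 3 = 0) (m : ℕ)
    (hm : m ≤ 4) :
    coeff m (prodSer (suzukiList L p)) = coeff m (expSer L.sum) := by
  have h : coeff 3 (prodSer (suzukiList L p)) = (6 : ℂ)⁻¹ • (suzukiList L p).sum ^ 3 := by
    obtain ⟨D, hD⟩ := cubicApprox_symList L
    have h := ((((hD p).mul (hD p)).mul (hD (1 - 4 * p))).mul (hD p)).mul (hD p)
    rw [← prodSer_append, ← prodSer_append, ← prodSer_append, ← prodSer_append, ← suzukiList] at h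
    rw [h.three, sum_suzukiList, ← add_smul, ← add_smul, ← add_smul, ← add_smul,
      show p ^ 3 + p ^ 3 + (1 - 4 * p) ^ 3 + p ^ 3 + p ^ 3 = 0 by rw [← hp]; ring,
      show p + p + (1 - 4 * p) + p + p = 1 by ring, zero_smul, add_zero, one_smul]
  rw [coeff_eq_of_palindrome (suzukiList_reverse L p) h m hm, sum_suzukiList]

end Order

/-! ### Sums over pairs of members of a list -/

section PairSums

variable {A : Type*} [NormedRing A]

/-- The sum of the norms of the commutators `[X, Y]` with `X` in `l` and `Y` in `l'`. -/
noncomputable def crossSum (l l' : List A) : ℝ :=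
  (l.map fun X => (l'.map fun Y => ‖X * Y - Y * X‖).sum).sum

@[simp] theorem crossSum_nil_left (l : List A) : crossSum [] l = 0 := rfl

@[simp] theorem crossSum_nil_right (l : List A) : crossSum l [] = 0 := by simp [crossSum]

theorem crossSum_append_left (l₁ l₂ l : List A) :
    crossSum (l₁ ++ l₂) l = crossSum l₁ l + crossSum l₂ l := by simp [crossSum]

theorem crossSum_append_right (l l₁ l₂ : List A) :
    crossSum l (l₁ ++ l₂) = crossSum l l₁ + crossSum l l₂ := by
  simp [crossSum, List.sum_map_add]

theorem crossSum_comm (l l' : List A) : crossSum l l' = crossSum l' l := by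
  induction l with
  | nil => simp
  | cons X l ih =>
    have h1 : crossSum (X :: l) l' = crossSum [X] l' + crossSum l l' :=
      crossSum_append_left [X] l l'
    have h2 : crossSum l' (X :: l) = crossSum l' [X] + crossSum l' l :=
      crossSum_append_right l' [X] l
    rw [h1, h2, ih]
    simp [crossSum, norm_sub_rev]

theorem two_mul_commSum (l : List A) : 2 * commSum l = crossSum l l := by
  induction l with
  | nil => simp [commSum]
  | cons X l ih =>
    have h1 : crossSum (X :: l) (X :: l) = crossSum [X] (X :: l) + crossSum l (X :: l) :=
      crossSum_append_left [X] l _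
    have h2 : crossSum l (X :: l) = crossSum l [X] + crossSum l l :=
      crossSum_append_right l [X] l
    rw [h1, h2, crossSum_comm l [X], ← ih]
    simp [crossSum, commSum]
    ring

theorem crossSum_reverse_left (l l' : List A) : crossSum l.reverse l' = crossSum l l' := by
  simp [crossSum, List.sum_reverse]

theorem crossSum_reverse_right (l l' : List A) : crossSum l l'.reverse = crossSum l l' := by
  rw [crossSum_comm, crossSum_reverse_left, crossSum_comm]

theorem crossSum_smul [NormedAlgebra ℂ A] (a b : ℂ) (l l' : List A) :
    crossSum (l.map fun B => a • B) (l'.map fun B => b • B) = ‖a‖ * ‖b‖ * crossSum l l' := by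
  simp only [crossSum, List.map_map, ← List.sum_map_mul_left]
  refine congrArg List.sum (List.map_congr_left fun X _ => ?_)
  refine congrArg List.sum (List.map_congr_left fun Y _ => ?_)
  simp only [Function.comp_apply, smul_mul_smul_comm, mul_comm b a, ← smul_sub, norm_smul, norm_mul]

theorem normSum_append (l l' : List A) : normSum (l ++ l') = normSum l + normSum l' := by
  simp [normSum]

variable [NormedAlgebra ℂ A]

/-- Each term occurs twice with half the weight, and the order of the list does not matter for this
sum. -/
theorem crossSum_symList (L : List A) (a b : ℂ) :
    crossSum (symList L a) (symList L b) = ‖a‖ * ‖b‖ * crossSum L L := by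
  rw [symList, symList, crossSum_smul, crossSum_append_left, crossSum_append_right,
    crossSum_append_right, crossSum_reverse_left, crossSum_reverse_left, crossSum_reverse_right,
    norm_div, norm_div, Complex.norm_ofNat]
  ring

theorem commSum_suzukiList (L : List A) (p : ℂ) :
    commSum (suzukiList L p) = (4 * ‖p‖ + ‖1 - 4 * p‖) ^ 2 * crossSum L L / 2 := by
  have h := two_mul_commSum (suzukiList L p)
  simp only [suzukiList, crossSum_append_left, crossSum_append_right, crossSum_symList] at h
  rw [eq_div_iff two_ne_zero, mul_comm, suzukiList, h]
  ring

theorem normSum_symList (L : List A) (a : ℂ) : normSum (symList L a) = ‖a‖ * normSum L := by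
  have h : ∀ l : List A, normSum (l.map fun B => (a / 2) • B) = ‖a‖ / 2 * normSum l := by
    intro l
    simp [normSum, List.map_map, ← List.sum_map_mul_left, norm_smul, Function.comp_def]
  rw [symList, h, normSum_append]
  simp [normSum, List.sum_reverse]
  ring

theorem normSum_suzukiList (L : List A) (p : ℂ) :
    normSum (suzukiList L p) = (4 * ‖p‖ + ‖1 - 4 * p‖) * normSum L := by
  simp only [suzukiList, normSum_append, normSum_symList]
  ring

end PairSums

end HeisenbergPF

/-! ### Tensor products of single-qubit operators -/

namespace HeisenbergPF

open Finset Matrix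

section Qubits

variable {n : ℕ}

theorem tensor_mul (A B : Fin n → Matrix (Fin 2) (Fin 2) ℂ) :
    tensor A * tensor B = tensor fun j => A j * B j := by
  ext s t
  simp only [tensor, Matrix.mul_apply, Matrix.of_apply, ← prod_mul_distrib]
  exact (Fintype.prod_sum fun j k => A j (s j) k * B j k (t j)).symm

theorem tensor_one : tensor (fun _ : Fin n => (1 : Matrix (Fin 2) (Fin 2) ℂ)) = 1 := by
  ext s t
  simp only [tensor, Matrix.of_apply, Matrix.one_apply, prod_ite_zero, prod_const_one]
  exact if_congr (by simp [funext_iff]) rfl rfl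

theorem tensor_conjTranspose (A : Fin n → Matrix (Fin 2) (Fin 2) ℂ) :
    (tensor A)ᴴ = tensor fun j => (A j)ᴴ := by
  ext s t
  simp [tensor, Matrix.conjTranspose_apply]

theorem onQubit_one (j : Fin n) : onQubit j 1 = (1 : Op n) := by
  rw [onQubit, Function.update_eq_self j (fun _ => (1 : Matrix (Fin 2) (Fin 2) ℂ)), tensor_one]

theorem onQubit_mul (j : Fin n) (A B : Matrix (Fin 2) (Fin 2) ℂ) :
    onQubit j A * onQubit j B = onQubit j (A * B) := by
  rw [onQubit, onQubit, tensor_mul, onQubit]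
  congr 1
  ext1 k
  rcases eq_or_ne k j with rfl | hk
  · simp
  · simp [hk]

theorem onQubit_commute {j k : Fin n} (hjk : j ≠ k) (A B : Matrix (Fin 2) (Fin 2) ℂ) :
    onQubit j A * onQubit k B = onQubit k B * onQubit j A := by
  rw [onQubit, onQubit, tensor_mul, tensor_mul]
  congr 1
  ext1 l
  rcases eq_or_ne l j with rfl | hj
  · simp [hjk]
  · simp [hj]

theorem onQubit_smul (j : Fin n) (c : ℂ) (A : Matrix (Fin 2) (Fin 2) ℂ) :
    onQubit j (c • A) = c • onQubit j A := by
  ext s t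
  simp only [onQubit, tensor, Matrix.of_apply, Matrix.smul_apply, smul_eq_mul]
  rw [← mul_prod_erase univ _ (mem_univ j), ← mul_prod_erase univ _ (mem_univ j)]
  simp only [Function.update_self, Matrix.smul_apply, smul_eq_mul, mul_assoc]
  congr 2
  refine prod_congr rfl fun k hk => ?_
  simp [ne_of_mem_erase hk]

theorem onQubit_conjTranspose (j : Fin n) (A : Matrix (Fin 2) (Fin 2) ℂ) :
    (onQubit j A)ᴴ = onQubit j Aᴴ := by
  rw [onQubit, tensor_conjTranspose, onQubit]
  congr 1
  ext1 k
  rcases eq_or_ne k j with rfl | hk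
  · simp
  · simp [hk]

theorem onQubit_anticommute (j : Fin n) {A B : Matrix (Fin 2) (Fin 2) ℂ} (h : A * B = -(B * A)) :
    onQubit j A * onQubit j B = -(onQubit j B * onQubit j A) := by
  rw [onQubit_mul, onQubit_mul, h, ← neg_one_smul ℂ (B * A), onQubit_smul, neg_one_smul]

/-! ### Commutation relations of the terms -/

theorem nextSite_injective : Function.Injective (nextSite : Fin n → Fin n) := by
  intro i j h
  have h' : (i.val + 1) % n = (j.val + 1) % n := congrArg Fin.val h
  have hi := i.isLt
  have hj := j.isLt
  ext
  rcases Nat.lt_or_ge (i.val + 1) n with h1 | h1 <;> rcases Nat.lt_or_ge (j.val + 1) n with h2 | h2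
  · rw [Nat.mod_eq_of_lt h1, Nat.mod_eq_of_lt h2] at h'
    omega
  · rw [Nat.mod_eq_of_lt h1, show j.val + 1 = n by omega, Nat.mod_self] at h'
    omega
  · rw [Nat.mod_eq_of_lt h2, show i.val + 1 = n by omega, Nat.mod_self] at h'
    omega
  · omega

theorem nextSite_ne (hn : 2 ≤ n) (j : Fin n) : nextSite j ≠ j := by
  intro h
  have h' : (j.val + 1) % n = j.val := congrArg Fin.val h
  have hj := j.isLt
  rcases Nat.lt_or_ge (j.val + 1) n with h1 | h1
  · rw [Nat.mod_eq_of_lt h1] at h'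
    omega
  · rw [show j.val + 1 = n by omega, Nat.mod_self] at h'
    omega

theorem bond_commute_onQubit {A B : Matrix (Fin 2) (Fin 2) ℂ} {i j : Fin n} (h₁ : j ≠ i)
    (h₂ : j ≠ nextSite i) : bond A i * onQubit j B = onQubit j B * bond A i := by
  rw [bond, mul_assoc, onQubit_commute h₂.symm, ← mul_assoc, onQubit_commute h₁.symm, mul_assoc]

/-- On a common bond the signs from the two sites cancel; only bonds sharing exactly one site can
fail to commute. -/
theorem bond_commute_bond (hn : 2 ≤ n) {A B : Matrix (Fin 2) (Fin 2) ℂ} (hAB : A * B = -(B * A))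
    {i j : Fin n} (h₁ : j ≠ nextSite i) (h₂ : nextSite j ≠ i) :
    bond A i * bond B j = bond B j * bond A i := by
  rcases eq_or_ne j i with rfl | hij
  · have hne := nextSite_ne hn j
    have e1 : bond A j * bond B j
        = (onQubit j A * onQubit j B) * (onQubit (nextSite j) A * onQubit (nextSite j) B) := by
      rw [bond, bond, mul_assoc, ← mul_assoc (onQubit (nextSite j) A),
        onQubit_commute hne A B]
      simp only [mul_assoc]
    have e2 : bond B j * bond A j
        = (onQubit j B * onQubit j A) * (onQubit (nextSite j) B * onQubit (nextSite j) A) := by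
      rw [bond, bond, mul_assoc, ← mul_assoc (onQubit (nextSite j) B),
        onQubit_commute hne B A]
      simp only [mul_assoc]
    rw [e1, e2, onQubit_anticommute _ hAB, onQubit_anticommute _ hAB, neg_mul_neg]
  · have h3 : nextSite j ≠ nextSite i := fun h => hij (nextSite_injective h)
    rw [bond.eq_1 B, ← mul_assoc, bond_commute_onQubit hij h₁, mul_assoc,
      bond_commute_onQubit h₂ h3, mul_assoc]

theorem bond_commute_bond_self {A : Matrix (Fin 2) (Fin 2) ℂ} (i j : Fin n) :
    bond A i * bond A j = bond A j * bond A i := by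
  have h : ∀ k l : Fin n, onQubit k A * onQubit l A = onQubit l A * onQubit k A := by
    intro k l
    rcases eq_or_ne k l with rfl | hkl
    · rfl
    · exact onQubit_commute hkl _ _
  have hc : Commute (bond A i) (bond A j) :=
    Commute.mul_left (Commute.mul_right (h _ _) (h _ _)) (Commute.mul_right (h _ _) (h _ _))
  exact hc

theorem bond_commute_onQubit_self {A : Matrix (Fin 2) (Fin 2) ℂ} (i j : Fin n) :
    bond A i * onQubit j A = onQubit j A * bond A i := by
  have h : ∀ k l : Fin n, onQubit k A * onQubit l A = onQubit l A * onQubit k A := by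
    intro k l
    rcases eq_or_ne k l with rfl | hkl
    · rfl
    · exact onQubit_commute hkl _ _
  have hc : Commute (bond A i) (onQubit j A) := Commute.mul_left (h _ _) (h _ _)
  exact hc

theorem pauliX_mul_pauliY : pauliX * pauliY = -(pauliY * pauliX) := by
  ext i j; fin_cases i <;> fin_cases j <;> simp [pauliX, pauliY]

theorem pauliX_mul_pauliZ : pauliX * pauliZ = -(pauliZ * pauliX) := by
  ext i j; fin_cases i <;> fin_cases j <;> simp [pauliX, pauliZ]

theorem pauliY_mul_pauliZ : pauliY * pauliZ = -(pauliZ * pauliY) := by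
  ext i j; fin_cases i <;> fin_cases j <;> simp [pauliY, pauliZ]

theorem pauliX_conjTranspose : pauliXᴴ = pauliX := by
  ext i j; fin_cases i <;> fin_cases j <;> simp [pauliX]

theorem pauliY_conjTranspose : pauliYᴴ = pauliY := by
  ext i j; fin_cases i <;> fin_cases j <;> simp [pauliY]

theorem pauliZ_conjTranspose : pauliZᴴ = pauliZ := by
  ext i j; fin_cases i <;> fin_cases j <;> simp [pauliZ]

theorem pauliX_mul_self : pauliX * pauliX = 1 := by
  ext i j; fin_cases i <;> fin_cases j <;> simp [pauliX]

theorem pauliY_mul_self : pauliY * pauliY = 1 := by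
  ext i j; fin_cases i <;> fin_cases j <;> simp [pauliY]

theorem pauliZ_mul_self : pauliZ * pauliZ = 1 := by
  ext i j; fin_cases i <;> fin_cases j <;> simp [pauliZ]

theorem bond_conjTranspose {A : Matrix (Fin 2) (Fin 2) ℂ} (hA : Aᴴ = A) (j : Fin n) :
    (bond A j)ᴴ = bond A j := by
  rw [bond, Matrix.conjTranspose_mul, onQubit_conjTranspose, onQubit_conjTranspose, hA]
  rcases eq_or_ne (nextSite j) j with h | h
  · rw [h]
  · exact onQubit_commute h _ _

/-! ### The list of terms -/

theorem mem_terms {h : Fin n → ℝ} {B : Op n} (hB : B ∈ terms h) :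
    ∃ j, B = bond pauliX j ∨ B = bond pauliY j ∨ B = bond pauliZ j
      ∨ B = (h j : ℂ) • onQubit j pauliZ := by
  simp only [terms, List.mem_append, List.mem_ofFn'] at hB
  rcases hB with ((⟨j, rfl⟩ | ⟨j, rfl⟩) | ⟨j, rfl⟩) | ⟨j, rfl⟩ <;> exact ⟨j, by simp⟩

theorem terms_conjTranspose {h : Fin n → ℝ} {B : Op n} (hB : B ∈ terms h) : Bᴴ = B := by
  obtain ⟨j, rfl | rfl | rfl | rfl⟩ := mem_terms hB
  · exact bond_conjTranspose pauliX_conjTranspose j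
  · exact bond_conjTranspose pauliY_conjTranspose j
  · exact bond_conjTranspose pauliZ_conjTranspose j
  · rw [Matrix.conjTranspose_smul, onQubit_conjTranspose, pauliZ_conjTranspose]
    simp

theorem sum_terms (h : Fin n → ℝ) : (terms h).sum = hamiltonian h := by
  simp only [terms, List.sum_append, List.sum_ofFn, hamiltonian, sum_add_distrib]

theorem length_terms (h : Fin n → ℝ) : (terms h).length = 4 * n := by
  simp [terms]
  ring

theorem maxNorm_nonneg (L : List (Op n)) : 0 ≤ maxNorm L := by
  rcases L with _ | ⟨B, L⟩ <;> simp [maxNorm]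

theorem norm_le_maxNorm {L : List (Op n)} {B : Op n} (hB : B ∈ L) : ‖B‖ ≤ maxNorm L := by
  induction L with
  | nil => simp at hB
  | cons C L ih =>
    have e : maxNorm (C :: L) = max ‖C‖ (maxNorm L) := rfl
    rw [e]
    rcases List.mem_cons.1 hB with rfl | h
    · exact le_max_left _ _
    · exact (ih h).trans (le_max_right _ _)

theorem maxNorm_le {L : List (Op n)} {K : ℝ} (hK : 0 ≤ K) (h : ∀ B ∈ L, ‖B‖ ≤ K) :
    maxNorm L ≤ K := by
  induction L with
  | nil => simpa [maxNorm] using hK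
  | cons C L ih =>
    have e : maxNorm (C :: L) = max ‖C‖ (maxNorm L) := rfl
    rw [e]
    exact max_le (h C (by simp)) (ih fun B hB => h B (by simp [hB]))

theorem normSum_le_length_mul (L : List (Op n)) {K : ℝ} (h : ∀ B ∈ L, ‖B‖ ≤ K) :
    normSum L ≤ L.length * K := by
  induction L with
  | nil => simp
  | cons C L ih =>
    have h1 := h C (by simp)
    have h2 := ih fun B hB => h B (by simp [hB])
    simp only [normSum_cons, List.length_cons, Nat.cast_add, Nat.cast_one]
    linarith

theorem normSum_terms_le (h : Fin n → ℝ) : normSum (terms h) ≤ 4 * n * maxNorm (terms h) := by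
  have := normSum_le_length_mul (terms h) fun B hB => norm_le_maxNorm hB
  rw [length_terms] at this
  exact_mod_cast this

theorem crossSum_ofFn (f g : Fin n → Op n) :
    crossSum (List.ofFn f) (List.ofFn g) = ∑ i, ∑ j, ‖f i * g j - g j * f i‖ := by
  simp [crossSum, List.map_ofFn, List.sum_ofFn, Function.comp_def]

theorem norm_commutator_le {B C : Op n} {K : ℝ} (hB : ‖B‖ ≤ K) (hC : ‖C‖ ≤ K) :
    ‖B * C - C * B‖ ≤ 2 * K ^ 2 := by
  have hK : 0 ≤ K := (norm_nonneg _).trans hB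
  have h1 : ‖B * C‖ ≤ K * K := (norm_mul_le _ _).trans (by gcongr)
  have h2 : ‖C * B‖ ≤ K * K := (norm_mul_le _ _).trans (by gcongr)
  have h3 := norm_sub_le (B * C) (C * B)
  linarith

theorem sum_le_of_two_exceptions {a : Fin n → ℝ} {K : ℝ} (hK : 0 ≤ K) {k l : Fin n}
    (h : ∀ j, a j ≤ K) (h0 : ∀ j, j ≠ k → j ≠ l → a j = 0) : ∑ j, a j ≤ 2 * K := by
  have : ∀ j, a j ≤ (if j = k then K else 0) + (if j = l then K else 0) := by
    intro j
    by_cases hk : j = k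
    · rw [if_pos hk]
      split_ifs <;> linarith [h j]
    · by_cases hl : j = l
      · rw [if_neg hk, if_pos hl, zero_add]
        exact h j
      · rw [if_neg hk, if_neg hl, h0 j hk hl, zero_add]
  refine (sum_le_sum fun j _ => this j).trans (le_of_eq ?_)
  rw [sum_add_distrib, sum_ite_eq' univ k, sum_ite_eq' univ l]
  simp
  ring

theorem crossSum_bond_le (hn : 2 ≤ n) {A B : Matrix (Fin 2) (Fin 2) ℂ} (hAB : A * B = -(B * A))
    {K : ℝ} (hA : ∀ j : Fin n, ‖bond A j‖ ≤ K) (hB : ∀ j : Fin n, ‖bond B j‖ ≤ K) :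
    crossSum (List.ofFn fun j : Fin n => bond A j) (List.ofFn fun j : Fin n => bond B j)
      ≤ 4 * n * K ^ 2 := by
  rw [crossSum_ofFn]
  have : ∀ i : Fin n, ∑ j, ‖bond A i * bond B j - bond B j * bond A i‖ ≤ 2 * (2 * K ^ 2) := by
    intro i
    -- The two exceptional bonds are the cyclic successor of `i` and its predecessor `k`.
    obtain ⟨k, hk⟩ := (Finite.injective_iff_surjective.1 nextSite_injective) i
    refine sum_le_of_two_exceptions (k := nextSite i) (l := k) (by positivity)
      (fun j => norm_commutator_le (hA i) (hB j)) fun j hj hj' => ?_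
    rw [bond_commute_bond hn hAB hj fun h => hj' (nextSite_injective (h.trans hk.symm)), sub_self,
      norm_zero]
  refine (sum_le_sum fun i _ => this i).trans (le_of_eq ?_)
  simp
  ring

theorem crossSum_field_le {A : Matrix (Fin 2) (Fin 2) ℂ} (h : Fin n → ℝ)
    {K : ℝ} (hA : ∀ j : Fin n, ‖bond A j‖ ≤ K)
    (hB : ∀ j : Fin n, ‖(h j : ℂ) • onQubit j pauliZ‖ ≤ K) :
    crossSum (List.ofFn fun j : Fin n => bond A j)
      (List.ofFn fun j : Fin n => (h j : ℂ) • onQubit j pauliZ) ≤ 4 * n * K ^ 2 := by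
  rw [crossSum_ofFn]
  have : ∀ i : Fin n, ∑ j, ‖bond A i * ((h j : ℂ) • onQubit j pauliZ)
      - ((h j : ℂ) • onQubit j pauliZ) * bond A i‖ ≤ 2 * (2 * K ^ 2) := by
    intro i
    refine sum_le_of_two_exceptions (k := i) (l := nextSite i) (by positivity)
      (fun j => norm_commutator_le (hA i) (hB j)) fun j hj hj' => ?_
    rw [mul_smul_comm, bond_commute_onQubit hj hj', smul_mul_assoc, sub_self, norm_zero]
  refine (sum_le_sum fun i _ => this i).trans (le_of_eq ?_)
  simp
  ring

theorem crossSum_eq_zero {f g : Fin n → Op n} (h : ∀ i j, f i * g j = g j * f i) :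
    crossSum (List.ofFn f) (List.ofFn g) = 0 := by
  rw [crossSum_ofFn]
  simp [h]

/-- Five pairs of families do not commute (XY, XZ, YZ, X-field, Y-field); each contributes at most
`4 n K²` and is counted in both orders. The bound is linear in `n`, which is the saving over the
trivial quadratic one. -/
theorem crossSum_terms_le (hn : 2 ≤ n) (h : Fin n → ℝ) :
    crossSum (terms h) (terms h) ≤ 40 * n * maxNorm (terms h) ^ 2 := by
  set K := maxNorm (terms h) with hK
  have bX : ∀ j : Fin n, ‖bond pauliX j‖ ≤ K := fun j => norm_le_maxNorm (by simp [terms])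
  have bY : ∀ j : Fin n, ‖bond pauliY j‖ ≤ K := fun j => norm_le_maxNorm (by simp [terms])
  have bZ : ∀ j : Fin n, ‖bond pauliZ j‖ ≤ K := fun j => norm_le_maxNorm (by simp [terms])
  have bF : ∀ j : Fin n, ‖(h j : ℂ) • onQubit j pauliZ‖ ≤ K := fun j =>
    norm_le_maxNorm (by simp [terms])
  have hXY := crossSum_bond_le hn pauliX_mul_pauliY bX bY
  have hXZ := crossSum_bond_le hn pauliX_mul_pauliZ bX bZ
  have hYZ := crossSum_bond_le hn pauliY_mul_pauliZ bY bZ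
  have hXF := crossSum_field_le h bX bF
  have hYF := crossSum_field_le h bY bF
  have hXX := crossSum_eq_zero (n := n) (bond_commute_bond_self (A := pauliX))
  have hYY := crossSum_eq_zero (n := n) (bond_commute_bond_self (A := pauliY))
  have hZZ := crossSum_eq_zero (n := n) (bond_commute_bond_self (A := pauliZ))
  have hZF : crossSum (List.ofFn fun j : Fin n => bond pauliZ j)
      (List.ofFn fun j : Fin n => (h j : ℂ) • onQubit j pauliZ) = 0 :=
    crossSum_eq_zero fun i j => by
      rw [mul_smul_comm, smul_mul_assoc, bond_commute_onQubit_self]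
  have hFF : crossSum (List.ofFn fun j : Fin n => (h j : ℂ) • onQubit j pauliZ)
      (List.ofFn fun j : Fin n => (h j : ℂ) • onQubit j pauliZ) = 0 :=
    crossSum_eq_zero fun i j => by
      rw [smul_mul_smul_comm, smul_mul_smul_comm, mul_comm (h i : ℂ)]
      congr 1
      rcases eq_or_ne i j with rfl | hij
      · rfl
      · exact onQubit_commute hij _ _
  simp only [terms, crossSum_append_left, crossSum_append_right]
  rw [crossSum_comm (List.ofFn fun j : Fin n => bond pauliY j) (List.ofFn fun j => bond pauliX j),
    crossSum_comm (List.ofFn fun j : Fin n => bond pauliZ j) (List.ofFn fun j => bond pauliX j),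
    crossSum_comm (List.ofFn fun j : Fin n => bond pauliZ j) (List.ofFn fun j => bond pauliY j),
    crossSum_comm (List.ofFn fun j : Fin n => (h j : ℂ) • onQubit j pauliZ)
      (List.ofFn fun j => bond pauliX j),
    crossSum_comm (List.ofFn fun j : Fin n => (h j : ℂ) • onQubit j pauliZ)
      (List.ofFn fun j => bond pauliY j),
    crossSum_comm (List.ofFn fun j : Fin n => (h j : ℂ) • onQubit j pauliZ)
      (List.ofFn fun j => bond pauliZ j)]
  linarith

end Qubits

end HeisenbergPF

/-! ### The error of the fourth-order formula -/

namespace HeisenbergPF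

open Finset Matrix

/-- With `c³ = 4`, the definition `p (4 - c) = 1` says `4p - 1 = c p`; cube it. -/
theorem suzukiP_cubic : 4 * suzukiP ^ 3 + (1 - 4 * suzukiP) ^ 3 = 0 := by
  have h0 : (0 : ℝ) ≤ (4 : ℝ) ^ (1 / 3 : ℝ) := by positivity
  have h3 : ((4 : ℝ) ^ (1 / 3 : ℝ)) ^ 3 = 4 := by
    rw [← Real.rpow_natCast, ← Real.rpow_mul (by norm_num)]
    norm_num
  set c := (4 : ℝ) ^ (1 / 3 : ℝ) with hc
  have hc4 : c < 4 := by nlinarith [sq_nonneg c, sq_nonneg (c - 4)]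
  have hne : 4 - c ≠ 0 := by linarith
  rw [suzukiP, ← hc]
  field_simp
  linear_combination -h3

theorem suzukiP_ge : 2 / 5 ≤ suzukiP := by
  have h0 : (0 : ℝ) ≤ (4 : ℝ) ^ (1 / 3 : ℝ) := by positivity
  have h3 : ((4 : ℝ) ^ (1 / 3 : ℝ)) ^ 3 = 4 := by
    rw [← Real.rpow_natCast, ← Real.rpow_mul (by norm_num)]
    norm_num
  set c := (4 : ℝ) ^ (1 / 3 : ℝ) with hc
  have hc4 : c < 4 := by nlinarith [sq_nonneg c, sq_nonneg (c - 4)]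
  -- `(3/2)³ = 27/8 < 4`, and `1 / (4 - 3/2) = 2/5`.
  have hc1 : 3 / 2 ≤ c := by
    by_contra! h
    have := pow_lt_pow_left₀ h h0 three_ne_zero
    norm_num at this
    linarith
  rw [suzukiP, ← hc, le_div_iff₀ (by linarith)]
  linarith

theorem le_T4 {n : ℕ} (hn : 3 ≤ n) : 271500000 * (n : ℝ) ^ 4 ≤ T4 n := by
  rw [T4]
  split_ifs with h3 h4 h5
  · subst h3; norm_num
  · subst h4; norm_num
  · subst h5; norm_num
  -- Expanded in `m = n - 6`, the difference has only positive coefficients.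
  · obtain ⟨m, rfl⟩ := Nat.exists_eq_add_of_le (show 6 ≤ n by omega)
    push_cast
    have hm : (0 : ℝ) ≤ m := Nat.cast_nonneg m
    rw [← sub_nonneg]
    ring_nf
    positivity

/-- Deliberately crude: only the order `n⁴` matters for the gate complexity. -/
theorem T4_le {n : ℕ} (hn : 3 ≤ n) : T4 n ≤ 25000000000 * (n : ℝ) ^ 4 := by
  have h3 : (3 : ℝ) ≤ n := by exact_mod_cast hn
  rw [T4]
  split_ifs with h3 h4 h5
  · subst h3; norm_num
  · subst h4; norm_num
  · subst h5; norm_num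
  · have e1 : (n : ℝ) ^ 2 ≤ (n : ℝ) ^ 4 / 9 := by
      have h9 : (9 : ℝ) ≤ (n : ℝ) ^ 2 := by nlinarith
      nlinarith
    have e2 : 0 ≤ (n : ℝ) ^ 3 := by positivity
    have e3 : 0 ≤ (n : ℝ) ^ 4 := by positivity
    linarith

/-- Here `8p - 1` is the total weight `4|p| + |1 - 4p|` of the formula. The fifth-order bound,
multiplied by `5!`, has the constant `(120/12) · 20 · 4³ = 12800`: 20 from the commutators, `4³`
from the cubed norm sum. -/
theorem pow_five_mul_le_T4 {n : ℕ} (hn : 3 ≤ n) :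
    12800 * (8 * suzukiP - 1) ^ 5 * (n : ℝ) ^ 4 ≤ ((4 * suzukiP - 1) / 2) ^ 5 * T4 n := by
  have hp := suzukiP_ge
  set q := (4 * suzukiP - 1) / 2 with hq
  -- The ratio `(8p - 1)/q = 4 + 2/(4p - 1)` decreases in `p` and equals `22/3` at `p = 2/5`.
  have hW : 8 * suzukiP - 1 ≤ 22 / 3 * q := by rw [hq]; linarith
  have hq0 : 0 ≤ q := by rw [hq]; linarith
  have h5 : (8 * suzukiP - 1) ^ 5 ≤ (22 / 3 * q) ^ 5 := pow_le_pow_left₀ (by linarith) hW 5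
  have hn4 : (0 : ℝ) ≤ (n : ℝ) ^ 4 := by positivity
  calc 12800 * (8 * suzukiP - 1) ^ 5 * (n : ℝ) ^ 4
      ≤ 12800 * (22 / 3 * q) ^ 5 * (n : ℝ) ^ 4 := by gcongr
    _ = q ^ 5 * (12800 * (22 / 3) ^ 5 * (n : ℝ) ^ 4) := by ring
    _ ≤ q ^ 5 * (271500000 * (n : ℝ) ^ 4) := by
        gcongr
        norm_num
    _ ≤ q ^ 5 * T4 n := by
        gcongr
        exact le_T4 hn

theorem norm_pow_sub_pow_le {A : Type*} [NormedRing A] [NormOneClass A] {U V : A} (hU : ‖U‖ ≤ 1)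
    (hV : ‖V‖ ≤ 1) (r : ℕ) : ‖U ^ r - V ^ r‖ ≤ r * ‖U - V‖ := by
  induction r with
  | zero => simp
  | succ r ih =>
    have e : U ^ (r + 1) - V ^ (r + 1) = U ^ r * (U - V) + (U ^ r - V ^ r) * V := by
      rw [pow_succ, pow_succ]; noncomm_ring
    have h1 : ‖U ^ r * (U - V)‖ ≤ 1 * ‖U - V‖ := (norm_mul_le _ _).trans (by
      gcongr
      exact (norm_pow_le U r).trans (pow_le_one₀ (norm_nonneg _) hU))
    have h2 : ‖(U ^ r - V ^ r) * V‖ ≤ r * ‖U - V‖ * 1 := (norm_mul_le _ _).trans (by gcongr)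
    rw [e]
    push_cast
    linarith [norm_add_le (U ^ r * (U - V)) ((U ^ r - V ^ r) * V)]

variable {n : ℕ}

theorem S4_eq_prod (L : List (Op n)) (z : ℂ) :
    S4 L z = ((suzukiList L (suzukiP : ℂ)).map fun B => NormedSpace.exp (z • B)).prod := by
  have h : ∀ a : ℂ, S2 L (a * z) = ((symList L a).map fun B => NormedSpace.exp (z • B)).prod := by
    intro a
    rw [S2, symList, List.map_map, List.map_append, List.prod_append]
    simp only [Function.comp_def, smul_smul]
    rw [show a * z / 2 = z * (a / 2) by ring]
  simp only [S4, h, suzukiList, List.map_append, List.prod_append, pow_two, mul_assoc]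

theorem exp_smul_mem_unitary (s : ℝ) {B : Op n} (hB : Bᴴ = B) :
    NormedSpace.exp ((-(Complex.I * s)) • B) ∈ unitary (Op n) := by
  let _ : NormedAlgebra ℚ (Op n) := NormedAlgebra.restrictScalars ℚ ℂ (Op n)
  refine NormedSpace.exp_mem_unitary_of_mem_skewAdjoint ?_
  rw [skewAdjoint.mem_iff, Matrix.star_eq_conjTranspose, Matrix.conjTranspose_smul, hB, ← neg_smul]
  congr 1
  simp

theorem norm_exp_smul_le_one (s : ℝ) {B : Op n} (hB : Bᴴ = B) :
    ‖NormedSpace.exp ((-(Complex.I * s)) • B)‖ ≤ 1 :=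
  (CStarRing.norm_of_mem_unitary (exp_smul_mem_unitary s hB)).le

/-- Every factor of the fourth-order formula is a real multiple of a term. -/
theorem mem_suzukiList {L : List (Op n)} {B : Op n} (hB : B ∈ suzukiList L (suzukiP : ℂ)) :
    ∃ c : ℝ, ∃ C ∈ L, B = (c : ℂ) • C := by
  have h : ∀ a : ℝ, B ∈ symList L (a : ℂ) → ∃ c : ℝ, ∃ C ∈ L, B = (c : ℂ) • C := by
    intro a ha
    simp only [symList, List.mem_map, List.mem_append, List.mem_reverse, or_self] at ha
    obtain ⟨C, hC, rfl⟩ := ha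
    exact ⟨a / 2, C, hC, by push_cast; rfl⟩
  have e : (1 - 4 * (suzukiP : ℂ)) = ((1 - 4 * suzukiP : ℝ) : ℂ) := by push_cast; rfl
  simp only [suzukiList, List.mem_append, e] at hB
  rcases hB with (((hB | hB) | hB) | hB) | hB <;> exact h _ hB

theorem norm_S4_le_one {L : List (Op n)} (hL : ∀ B ∈ L, Bᴴ = B) (s : ℝ) :
    ‖S4 L (-(Complex.I * s))‖ ≤ 1 := by
  rw [S4_eq_prod]
  refine List.prod_induction (fun U : Op n => ‖U‖ ≤ 1) (fun U V hU hV => ?_) (by simp) ?_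
  · exact (norm_mul_le _ _).trans (mul_le_one₀ hU (norm_nonneg _) hV)
  · simp only [List.mem_map]
    rintro _ ⟨B, hB, rfl⟩
    obtain ⟨c, C, hC, rfl⟩ := mem_suzukiList hB
    refine norm_exp_smul_le_one s ?_
    rw [Matrix.conjTranspose_smul, hL C hC]
    simp

theorem norm_exp_sub_S4_le (hn : 3 ≤ n) (h : Fin n → ℝ) (s : ℝ) :
    ‖NormedSpace.exp ((-(Complex.I * s)) • hamiltonian h) - S4 (terms h) (-(Complex.I * s))‖
      ≤ ((4 * suzukiP - 1) / 2 * maxNorm (terms h) * |s|) ^ 5 / (Nat.factorial 5 : ℝ) * T4 n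
        + 2 * ((20 * (4 * suzukiP - 1) * n * maxNorm (terms h) * |s|) ^ 6 / (Nat.factorial 6 : ℝ)
          * Real.exp (20 * (4 * suzukiP - 1) * n * maxNorm (terms h) * |s|)) := by
  have hp := suzukiP_ge
  set L := terms h with hL
  set K := maxNorm L with hK
  have hK0 : 0 ≤ K := maxNorm_nonneg L
  have hcub : 4 * (suzukiP : ℂ) ^ 3 + (1 - 4 * (suzukiP : ℂ)) ^ 3 = 0 := by
    exact_mod_cast suzukiP_cubic
  have hW : 4 * ‖(suzukiP : ℂ)‖ + ‖1 - 4 * (suzukiP : ℂ)‖ = 8 * suzukiP - 1 := by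
    have e : (1 - 4 * (suzukiP : ℂ)) = ((1 - 4 * suzukiP : ℝ) : ℂ) := by push_cast; rfl
    rw [e, Complex.norm_real, Complex.norm_real, Real.norm_eq_abs, Real.norm_eq_abs,
      abs_of_nonneg (by linarith : 0 ≤ suzukiP), abs_of_nonpos (by linarith)]
    ring
  have hW0 : 0 ≤ 8 * suzukiP - 1 := by linarith
  set l := suzukiList L (suzukiP : ℂ) with hl
  have hS : normSum l ≤ (8 * suzukiP - 1) * (4 * n * K) := by
    rw [hl, normSum_suzukiList, hW]
    exact mul_le_mul_of_nonneg_left (normSum_terms_le h) hW0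
  have hC : commSum l ≤ 20 * (8 * suzukiP - 1) ^ 2 * n * K ^ 2 := by
    rw [hl, commSum_suzukiList, hW]
    have := mul_le_mul_of_nonneg_left (crossSum_terms_le (by omega) h)
      (sq_nonneg (8 * suzukiP - 1))
    rw [← hL, ← hK] at this
    linarith
  -- `4 (8p - 1) ≤ 20 (4p - 1)` as soon as `p ≥ 1/3`.
  have hx : normSum l ≤ 20 * (4 * suzukiP - 1) * n * K := by
    refine hS.trans ?_
    have : 0 ≤ (n : ℝ) * K := by positivity
    nlinarith
  have hmain := norm_prod_exp_sub_exp_sum_le l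
    (fun m hm => by rw [hl, coeff_suzukiList L hcub m hm, sum_suzukiList])
    (-(Complex.I * s)) hx
  have hz : ‖-(Complex.I * (s : ℂ))‖ = |s| := by simp
  rw [hz, hl, sum_suzukiList, ← S4_eq_prod, sum_terms, norm_sub_rev, ← hl, mul_comm |s|] at hmain
  refine hmain.trans (add_le_add ?_ le_rfl)
  have hprod : commSum l * normSum l ^ 3
      ≤ 20 * (8 * suzukiP - 1) ^ 2 * n * K ^ 2 * ((8 * suzukiP - 1) * (4 * n * K)) ^ 3 := by
    gcongr
    · exact pow_nonneg (normSum_nonneg l) 3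
    · exact normSum_nonneg l
  have hT := mul_le_mul_of_nonneg_right (pow_five_mul_le_T4 hn)
    (by positivity : 0 ≤ K ^ 5 * |s| ^ 5)
  have hs := mul_le_mul_of_nonneg_right hprod (by positivity : 0 ≤ |s| ^ 5)
  have f5 : (Nat.factorial 5 : ℝ) = 120 := by norm_num [Nat.factorial]
  rw [f5, mul_pow, mul_pow]
  linarith

theorem norm_exp_sub_S4_pow_le (hn : 3 ≤ n) (h : Fin n → ℝ) (t : ℝ) {r : ℕ} (hr : 1 ≤ r) :
    ‖NormedSpace.exp ((-(Complex.I * t)) • hamiltonian h)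
        - S4 (terms h) (-(Complex.I * t) / r) ^ r‖
      ≤ ((4 * suzukiP - 1) / 2 * maxNorm (terms h) * |t|) ^ 5
            * (1 / ((Nat.factorial 5 : ℝ) * (r : ℝ) ^ 4)) * T4 n
        + 2 * ((20 * (4 * suzukiP - 1) * n * maxNorm (terms h) * t) ^ 6
              / ((Nat.factorial 6 : ℝ) * (r : ℝ) ^ 5))
            * Real.exp (20 * (4 * suzukiP - 1) * n * maxNorm (terms h) * |t| / r) := by
  let _ : NormedAlgebra ℚ (Op n) := NormedAlgebra.restrictScalars ℚ ℂ (Op n)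
  have hr0 : (0 : ℝ) < r := by exact_mod_cast hr
  have hrc : (r : ℂ) ≠ 0 := by exact_mod_cast hr0.ne'
  have ez : -(Complex.I * t) / r = -(Complex.I * ((t / r : ℝ) : ℂ)) := by
    push_cast
    ring
  have eexp : NormedSpace.exp ((-(Complex.I * t)) • hamiltonian h)
      = NormedSpace.exp ((-(Complex.I * ((t / r : ℝ) : ℂ))) • hamiltonian h) ^ r := by
    rw [← NormedSpace.exp_nsmul, ← Nat.cast_smul_eq_nsmul ℂ, smul_smul, ← ez]
    congr 2
    field_simp
  have hH : (hamiltonian h)ᴴ = hamiltonian h := by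
    rw [← sum_terms, Matrix.conjTranspose_list_sum]
    congr 1
    conv_rhs => rw [← List.map_id (terms h)]
    exact List.map_congr_left fun B hB => terms_conjTranspose hB
  rw [eexp, ez]
  refine (norm_pow_sub_pow_le (norm_exp_smul_le_one _ hH)
    (norm_S4_le_one (fun B hB => terms_conjTranspose hB) _) r).trans ?_
  refine (mul_le_mul_of_nonneg_left (norm_exp_sub_S4_le hn h (t / r)) hr0.le).trans (le_of_eq ?_)
  have habs : |t / (r : ℝ)| = |t| / r := by rw [abs_div, abs_of_pos hr0]
  have ht6 : t ^ 6 = |t| ^ 6 := by rw [Even.pow_abs (by decide)]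
  rw [habs, mul_pow _ t, ht6, ← mul_div_assoc]
  field_simp

end HeisenbergPF

/-! ### Circuits -/

namespace HeisenbergPF

open Finset Matrix

variable {n : ℕ}

/-- The operator `U` is the unitary of a circuit with at most `k` gates. -/
def HasCircuit (U : Op n) (k : ℕ) : Prop :=
  ∃ g : List (Gate n), circuitOp g = U ∧ g.length ≤ k

theorem Gate.hasCircuit (g : Gate n) : HasCircuit g.toOp 1 := ⟨[g], by simp [circuitOp], by simp⟩

theorem HasCircuit.mul {U V : Op n} {k l : ℕ} (hU : HasCircuit U k) (hV : HasCircuit V l) :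
    HasCircuit (U * V) (k + l) := by
  obtain ⟨g, rfl, hg⟩ := hU
  obtain ⟨g', rfl, hg'⟩ := hV
  -- Gates are listed in order of application, so the right factor comes first.
  refine ⟨g' ++ g, by simp [circuitOp], ?_⟩
  rw [List.length_append]
  omega

theorem HasCircuit.mono {U : Op n} {k l : ℕ} (hU : HasCircuit U k) (h : k ≤ l) :
    HasCircuit U l := by
  obtain ⟨g, hg, hk⟩ := hU
  exact ⟨g, hg, hk.trans h⟩

theorem HasCircuit.list_prod {l : List (Op n)} {k : ℕ} (h : ∀ U ∈ l, HasCircuit U k) :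
    HasCircuit l.prod (l.length * k) := by
  induction l with
  | nil => exact ⟨[], by simp [circuitOp], by simp⟩
  | cons U l ih =>
    rw [List.prod_cons, List.length_cons, Nat.succ_mul, add_comm]
    exact (h U (by simp)).mul (ih fun V hV => h V (by simp [hV]))

theorem HasCircuit.pow {U : Op n} {k : ℕ} (hU : HasCircuit U k) (r : ℕ) :
    HasCircuit (U ^ r) (r * k) := by
  have h := HasCircuit.list_prod (l := List.replicate r U) (k := k)
    fun V hV => (List.eq_of_mem_replicate hV) ▸ hU
  rwa [List.prod_replicate, List.length_replicate] at h

/-! ### Diagonal operators and CNOT conjugation -/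

theorem tensor_diagonal (d : Fin n → Fin 2 → ℂ) :
    tensor (fun k => diagonal (d k)) = diagonal fun s : Fin n → Fin 2 => ∏ k, d k (s k) := by
  ext s t
  simp only [tensor, Matrix.of_apply, Matrix.diagonal_apply, prod_ite_zero]
  by_cases h : s = t
  · simp [h]
  · have h' : ¬∀ k ∈ univ, s k = t k := fun hk => h (funext fun k => hk k (mem_univ k))
    rw [if_neg h', if_neg h]

theorem onQubit_diagonal (j : Fin n) (d : Fin 2 → ℂ) :
    onQubit j (diagonal d) = diagonal fun s : Fin n → Fin 2 => d (s j) := by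
  have e : Function.update (fun _ => (1 : Matrix (Fin 2) (Fin 2) ℂ)) j (diagonal d)
      = fun k => diagonal (Function.update (fun _ _ => (1 : ℂ)) j d k) := by
    ext1 k
    rcases eq_or_ne k j with rfl | hk
    · simp
    · simp [hk]
  rw [onQubit, e, tensor_diagonal]
  congr 1
  ext1 s
  rw [← mul_prod_erase univ _ (mem_univ j), Function.update_self, prod_eq_one, mul_one]
  intro k hk
  simp [ne_of_mem_erase hk]

theorem pauliZ_eq_diagonal : pauliZ = diagonal ![1, -1] := by
  ext i j; fin_cases i <;> fin_cases j <;> simp [pauliZ]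

theorem rz_toOp (θ : ℝ) (j : Fin n) :
    (Gate.rz θ j).toOp = diagonal fun s : Fin n → Fin 2 =>
      ![Complex.exp (-(Complex.I * θ / 2)), Complex.exp (Complex.I * θ / 2)] (s j) := by
  rw [Gate.toOp, ← onQubit_diagonal]
  congr 1
  ext i j; fin_cases i <;> fin_cases j <;> simp

theorem exp_smul_diagonal (a : ℂ) (v : (Fin n → Fin 2) → ℂ) :
    NormedSpace.exp (a • (diagonal v : Op n)) = diagonal fun s => Complex.exp (a * v s) := by
  rw [← Matrix.diagonal_smul, Matrix.exp_diagonal]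
  congr 1
  ext s
  rw [Pi.exp_def, Complex.exp_eq_exp_ℂ]
  rfl

theorem exp_pauliZ_eq_rz (θ : ℝ) (j : Fin n) :
    NormedSpace.exp ((-(Complex.I * θ / 2)) • onQubit j pauliZ) = (Gate.rz θ j).toOp := by
  rw [pauliZ_eq_diagonal, onQubit_diagonal, exp_smul_diagonal, rz_toOp]
  congr 1
  ext s
  generalize s j = a
  fin_cases a <;> simp

/-- The permutation of the computational basis given by a CNOT gate. -/
def cnotMap (c t : Fin n) (s : Fin n → Fin 2) : Fin n → Fin 2 :=
  Function.update s t (s t + s c)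

theorem cnotMap_involutive {c t : Fin n} (h : c ≠ t) : Function.Involutive (cnotMap c t) := by
  intro s
  ext1 k
  rcases eq_or_ne k t with rfl | hk
  · simp only [cnotMap, Function.update_self, Function.update_of_ne h, add_assoc]
    generalize s k = a
    generalize s c = b
    fin_cases a <;> fin_cases b <;> rfl
  · simp [cnotMap, hk]

/-- CNOT is the permutation matrix of an involution of the basis, so conjugation by it permutes
diagonal entries. -/
theorem cnot_mul_diagonal_mul_cnot {c t : Fin n} (h : c ≠ t) (v : (Fin n → Fin 2) → ℂ) :
    (Gate.cnot c t h).toOp * diagonal v * (Gate.cnot c t h).toOp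
      = diagonal fun s => v (cnotMap c t s) := by
  ext s s'
  rw [Matrix.mul_apply]
  simp only [Gate.toOp, Matrix.mul_diagonal, Matrix.of_apply]
  change ∑ x, (if s = cnotMap c t x then (1 : ℂ) else 0) * v x
    * (if x = cnotMap c t s' then 1 else 0) = _
  rw [sum_eq_single (cnotMap c t s') (fun x _ hx => by simp [hx]) (by simp),
    cnotMap_involutive h s', Matrix.diagonal_apply]
  by_cases hs : s = s'
  · simp [hs]
  · simp [hs]

/-- CNOT writes the parity of the two bits on the target, where `σᶻ` then has the eigenvalue of the
`zz` coupling. -/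
theorem exp_bondZ_eq_cnot (hn : 2 ≤ n) (θ : ℝ) (j : Fin n) :
    NormedSpace.exp ((-(Complex.I * θ / 2)) • bond pauliZ j)
      = (Gate.cnot j (nextSite j) (nextSite_ne hn j).symm).toOp * (Gate.rz θ (nextSite j)).toOp
        * (Gate.cnot j (nextSite j) (nextSite_ne hn j).symm).toOp := by
  rw [rz_toOp, cnot_mul_diagonal_mul_cnot, bond, pauliZ_eq_diagonal, onQubit_diagonal,
    onQubit_diagonal, Matrix.diagonal_mul_diagonal, exp_smul_diagonal]
  congr 1
  ext s
  simp only [cnotMap, Function.update_self]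
  generalize s j = a
  generalize s (nextSite j) = b
  fin_cases a <;> fin_cases b <;> simp

theorem hasCircuit_exp_bondZ (hn : 2 ≤ n) (θ : ℝ) (j : Fin n) :
    HasCircuit (NormedSpace.exp ((-(Complex.I * θ / 2)) • bond pauliZ j)) 3 := by
  rw [exp_bondZ_eq_cnot hn]
  exact ((Gate.hasCircuit _).mul (Gate.hasCircuit _)).mul (Gate.hasCircuit _)

/-! ### Basis changes -/

/-- The Hadamard matrix. -/
noncomputable def hadamardMatrix : Matrix (Fin 2) (Fin 2) ℂ :=
  ((1 / Real.sqrt 2 : ℝ) : ℂ) • !![1, 1; 1, -1]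

/-- The phase matrix `diag(1, i)`. -/
noncomputable def phaseMatrix : Matrix (Fin 2) (Fin 2) ℂ := !![1, 0; 0, Complex.I]

theorem hasCircuit_hadamard (j : Fin n) : HasCircuit (onQubit j hadamardMatrix) 1 :=
  Gate.hasCircuit (Gate.hadamard j)

theorem hasCircuit_phase (j : Fin n) : HasCircuit (onQubit j phaseMatrix) 1 :=
  Gate.hasCircuit (Gate.phase j)

theorem inv_sqrt_two_sq : (((1 / Real.sqrt 2 : ℝ) : ℂ)) * ((1 / Real.sqrt 2 : ℝ) : ℂ) = 1 / 2 := by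
  rw [← Complex.ofReal_mul, div_mul_div_comm, Real.mul_self_sqrt zero_le_two]
  norm_num

theorem hadamard_mul_self : hadamardMatrix * hadamardMatrix = 1 := by
  rw [hadamardMatrix, smul_mul_smul_comm, inv_sqrt_two_sq]
  ext i j; fin_cases i <;> fin_cases j <;> norm_num [Matrix.mul_apply]

theorem hadamard_conj_pauliZ : hadamardMatrix * pauliZ * hadamardMatrix = pauliX := by
  rw [hadamardMatrix, smul_mul_assoc, smul_mul_smul_comm, inv_sqrt_two_sq]
  ext i j; fin_cases i <;> fin_cases j <;> norm_num [Matrix.mul_apply, pauliX, pauliZ]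

theorem phase_mul_phase : phaseMatrix * phaseMatrix = pauliZ := by
  ext i j; fin_cases i <;> fin_cases j <;> simp [phaseMatrix, pauliZ]

theorem phase_conj_pauliX : phaseMatrix * pauliX * (pauliZ * phaseMatrix) = pauliY := by
  ext i j; fin_cases i <;> fin_cases j <;> simp [phaseMatrix, pauliX, pauliY, pauliZ]

theorem phase_mul_inv : phaseMatrix * (pauliZ * phaseMatrix) = 1 := by
  ext i j; fin_cases i <;> fin_cases j <;> simp [phaseMatrix, pauliZ]

theorem inv_mul_phase : pauliZ * phaseMatrix * phaseMatrix = 1 := by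
  rw [mul_assoc, phase_mul_phase, pauliZ_mul_self]

theorem hasCircuit_pauliZ (j : Fin n) : HasCircuit (onQubit j pauliZ) 2 := by
  rw [← phase_mul_phase, ← onQubit_mul]
  exact (hasCircuit_phase j).mul (hasCircuit_phase j)

theorem pair_mul_pair {j k : Fin n} (hjk : k ≠ j) (A B : Matrix (Fin 2) (Fin 2) ℂ) :
    (onQubit j A * onQubit k A) * (onQubit j B * onQubit k B)
      = onQubit j (A * B) * onQubit k (A * B) := by
  rw [← onQubit_mul, ← onQubit_mul, mul_assoc, ← mul_assoc (onQubit k A), onQubit_commute hjk]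
  simp only [mul_assoc]

/-- The exponential commutes with conjugation, so applying `U` to both sites of the bond changes the
coupling from `A` to `B`. -/
theorem hasCircuit_exp_conj (hn : 2 ≤ n) {U V A B : Matrix (Fin 2) (Fin 2) ℂ} (hUV : U * V = 1)
    (hVU : V * U = 1) (hB : U * A * V = B) {j : Fin n} {a : ℂ} {k l m : ℕ}
    (hU : ∀ i : Fin n, HasCircuit (onQubit i U) k) (hV : ∀ i : Fin n, HasCircuit (onQubit i V) l)
    (hA : HasCircuit (NormedSpace.exp (a • bond A j)) m) :
    HasCircuit (NormedSpace.exp (a • bond B j)) (k + k + m + (l + l)) := by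
  have hne := nextSite_ne hn j
  set W : (Op n)ˣ := ⟨onQubit j U * onQubit (nextSite j) U, onQubit j V * onQubit (nextSite j) V,
    by rw [pair_mul_pair hne, hUV, onQubit_one, onQubit_one, one_mul],
    by rw [pair_mul_pair hne, hVU, onQubit_one, onQubit_one, one_mul]⟩ with hW
  have e : a • bond B j = W.val * (a • bond A j) * W.inv := by
    rw [mul_smul_comm, smul_mul_assoc, ← hB, hW, bond, bond]
    simp only [pair_mul_pair hne]
  let _ : NormedAlgebra ℚ (Op n) := NormedAlgebra.restrictScalars ℚ ℂ (Op n)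
  rw [e, show W.inv = ((W⁻¹ : (Op n)ˣ) : Op n) from rfl, NormedSpace.exp_units_conj]
  exact (((hU _).mul (hU _)).mul hA).mul ((hV _).mul (hV _))

theorem hasCircuit_exp_bondX (hn : 2 ≤ n) (θ : ℝ) (j : Fin n) :
    HasCircuit (NormedSpace.exp ((-(Complex.I * θ / 2)) • bond pauliX j)) 7 :=
  hasCircuit_exp_conj hn hadamard_mul_self hadamard_mul_self hadamard_conj_pauliZ
    hasCircuit_hadamard hasCircuit_hadamard (hasCircuit_exp_bondZ hn θ j)

/-- The inverse of the phase gate is its cube, three gates: `15 = 2 + 7 + 6`. -/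
theorem hasCircuit_exp_bondY (hn : 2 ≤ n) (θ : ℝ) (j : Fin n) :
    HasCircuit (NormedSpace.exp ((-(Complex.I * θ / 2)) • bond pauliY j)) 15 :=
  hasCircuit_exp_conj hn phase_mul_inv inv_mul_phase phase_conj_pauliX
    hasCircuit_phase (fun i => by
      rw [← onQubit_mul]
      exact (hasCircuit_pauliZ i).mul (hasCircuit_phase i)) (hasCircuit_exp_bondX hn θ j)

theorem hasCircuit_exp_term (hn : 2 ≤ n) {h : Fin n → ℝ} {B : Op n} (hB : B ∈ terms h) (s : ℝ) :
    HasCircuit (NormedSpace.exp ((-(Complex.I * s)) • B)) 15 := by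
  have e : ∀ u : ℝ, -(Complex.I * u) = -(Complex.I * ((2 * u : ℝ) : ℂ) / 2) := by
    intro u
    push_cast
    ring
  obtain ⟨j, rfl | rfl | rfl | rfl⟩ := mem_terms hB
  · rw [e]
    exact (hasCircuit_exp_bondX hn _ j).mono (by norm_num)
  · rw [e]
    exact hasCircuit_exp_bondY hn _ j
  · rw [e]
    exact (hasCircuit_exp_bondZ hn _ j).mono (by norm_num)
  · rw [smul_smul, show -(Complex.I * (s : ℂ)) * (h j : ℂ) = -(Complex.I * ((s * h j : ℝ) : ℂ)) by
      push_cast; ring, e, exp_pauliZ_eq_rz]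
    exact (Gate.hasCircuit _).mono (by norm_num)

theorem length_suzukiList (L : List (Op n)) (p : ℂ) :
    (suzukiList L p).length = 10 * L.length := by
  simp [suzukiList, symList]
  ring

/-- Ten exponentials for each of the `4n` terms, at most 15 gates each. -/
theorem hasCircuit_S4 (hn : 2 ≤ n) (h : Fin n → ℝ) (s : ℝ) :
    HasCircuit (S4 (terms h) (-(Complex.I * s))) (600 * n) := by
  rw [S4_eq_prod]
  refine (HasCircuit.list_prod (k := 15) ?_).mono (le_of_eq ?_)
  · simp only [List.mem_map]
    rintro _ ⟨B, hB, rfl⟩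
    obtain ⟨c, C, hC, rfl⟩ := mem_suzukiList hB
    rw [smul_smul, show -(Complex.I * (s : ℂ)) * (c : ℂ) = -(Complex.I * ((s * c : ℝ) : ℂ)) by
      push_cast; ring]
    exact hasCircuit_exp_term hn hC _
  · rw [List.length_map, length_suzukiList, length_terms]
    ring

/-! ### Norms of the terms -/

theorem norm_onQubit_le_one {A : Matrix (Fin 2) (Fin 2) ℂ} (hA : Aᴴ = A) (hA2 : A * A = 1)
    (j : Fin n) : ‖onQubit j A‖ ≤ 1 := by
  have h : onQubit j A ∈ unitary (Op n) := by
    rw [Unitary.mem_iff, Matrix.star_eq_conjTranspose, onQubit_conjTranspose, hA, onQubit_mul,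
      hA2, onQubit_one]
    exact ⟨rfl, rfl⟩
  exact (CStarRing.norm_of_mem_unitary h).le

theorem norm_bond_le_one {A : Matrix (Fin 2) (Fin 2) ℂ} (hA : Aᴴ = A) (hA2 : A * A = 1)
    (j : Fin n) : ‖bond A j‖ ≤ 1 :=
  (norm_mul_le _ _).trans (mul_le_one₀ (norm_onQubit_le_one hA hA2 _) (norm_nonneg _)
    (norm_onQubit_le_one hA hA2 _))

theorem maxNorm_terms_le {h : Fin n → ℝ} {K : ℝ} (hK : 1 ≤ K) (hh : ∀ j, |h j| ≤ K) :
    maxNorm (terms h) ≤ K := by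
  refine maxNorm_le (by linarith) fun B hB => ?_
  obtain ⟨j, rfl | rfl | rfl | rfl⟩ := mem_terms hB
  · exact (norm_bond_le_one pauliX_conjTranspose pauliX_mul_self j).trans hK
  · exact (norm_bond_le_one pauliY_conjTranspose pauliY_mul_self j).trans hK
  · exact (norm_bond_le_one pauliZ_conjTranspose pauliZ_mul_self j).trans hK
  · rw [norm_smul, Complex.norm_real, Real.norm_eq_abs]
    have h1 := norm_onQubit_le_one pauliZ_conjTranspose pauliZ_mul_self j
    have := mul_le_mul (hh j) h1 (norm_nonneg _) (by linarith)
    linarith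

end HeisenbergPF

/-! ### Gate complexity -/

namespace HeisenbergPF

/-- With `n ≥ 1` sites, time `τ n` and `r ≥ c n^{12/5}` segments the error is `O(1/c)`. -/
theorem error_bound_le {n : ℕ} (hn : 3 ≤ n) {K T c Λ t r : ℝ} (hc : 1 ≤ c)
    (hΛ0 : 0 ≤ Λ) (hΛ : Λ ≤ K) (hT : 0 ≤ T) (ht : |t| ≤ T * n)
    (hr : c * (n : ℝ) ^ (12 / 5 : ℝ) ≤ r) :
    ((4 * suzukiP - 1) / 2 * Λ * |t|) ^ 5 * (1 / ((Nat.factorial 5 : ℝ) * r ^ 4)) * T4 n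
        + 2 * ((20 * (4 * suzukiP - 1) * n * Λ * t) ^ 6 / ((Nat.factorial 6 : ℝ) * r ^ 5))
            * Real.exp (20 * (4 * suzukiP - 1) * n * Λ * |t| / r)
      ≤ (((4 * suzukiP - 1) / 2 * K * T) ^ 5 / 120 * 25000000000
          + 2 * ((20 * (4 * suzukiP - 1) * K * T) ^ 6 / 720)
            * Real.exp (20 * (4 * suzukiP - 1) * K * T)) / c := by
  have hq : 0 ≤ 4 * suzukiP - 1 := by linarith [suzukiP_ge]
  set q := 4 * suzukiP - 1
  have hK : 0 ≤ K := hΛ0.trans hΛ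
  have hn1 : (1 : ℝ) ≤ n := by exact_mod_cast (by omega : 1 ≤ n)
  have hn0 : (0 : ℝ) ≤ n := by linarith
  -- The exponent is chosen so that `y⁵ = n¹²` balances the tail; `y⁴ ≥ n⁹` and `y ≥ n²` then hold
  -- with room to spare and control the fifth-order term and the exponential.
  set y := (n : ℝ) ^ (12 / 5 : ℝ) with hy
  have hy5 : y ^ 5 = (n : ℝ) ^ 12 := by
    rw [hy, ← Real.rpow_natCast, ← Real.rpow_mul hn0, ← Real.rpow_natCast]
    norm_num
  have hy2 : (n : ℝ) ^ 2 ≤ y := by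
    rw [hy, ← Real.rpow_natCast]
    exact Real.rpow_le_rpow_of_exponent_le hn1 (by norm_num)
  have hy4 : (n : ℝ) ^ 9 ≤ y ^ 4 := by
    rw [hy, ← Real.rpow_natCast, ← Real.rpow_natCast, ← Real.rpow_mul hn0]
    exact Real.rpow_le_rpow_of_exponent_le hn1 (by norm_num)
  have hy0 : 0 < y := lt_of_lt_of_le (by positivity) hy2
  have hc0 : 0 < c := by linarith
  have hr0 : 0 < r := lt_of_lt_of_le (by positivity) hr
  have hr5 : c * (n : ℝ) ^ 12 ≤ r ^ 5 := by
    calc c * (n : ℝ) ^ 12 ≤ c ^ 5 * (n : ℝ) ^ 12 := by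
          gcongr
          exact le_self_pow₀ hc (by norm_num)
      _ = (c * y) ^ 5 := by rw [mul_pow, hy5]
      _ ≤ r ^ 5 := by gcongr
  have hr4 : c * (n : ℝ) ^ 9 ≤ r ^ 4 := by
    calc c * (n : ℝ) ^ 9 ≤ c ^ 4 * y ^ 4 := by
          gcongr
          exact le_self_pow₀ hc (by norm_num)
      _ = (c * y) ^ 4 := by rw [mul_pow]
      _ ≤ r ^ 4 := by gcongr
  have hr2 : (n : ℝ) ^ 2 ≤ r := hy2.trans ((le_mul_of_one_le_left hy0.le hc).trans hr)
  have f5 : (Nat.factorial 5 : ℝ) = 120 := by norm_num [Nat.factorial]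
  have f6 : (Nat.factorial 6 : ℝ) = 720 := by norm_num [Nat.factorial]
  have hnpos : (0 : ℝ) < n := by linarith
  have e1 : (q / 2 * Λ * |t|) ^ 5 * (1 / ((Nat.factorial 5 : ℝ) * r ^ 4)) * T4 n
      ≤ (q / 2 * K * T) ^ 5 / 120 * 25000000000 / c := by
    calc (q / 2 * Λ * |t|) ^ 5 * (1 / ((Nat.factorial 5 : ℝ) * r ^ 4)) * T4 n
        ≤ (q / 2 * Λ * |t|) ^ 5 * (1 / ((Nat.factorial 5 : ℝ) * r ^ 4))
          * (25000000000 * (n : ℝ) ^ 4) := by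
          gcongr
          exact T4_le hn
      _ ≤ (q / 2 * K * (T * n)) ^ 5 * (1 / ((Nat.factorial 5 : ℝ) * (c * (n : ℝ) ^ 9)))
          * (25000000000 * (n : ℝ) ^ 4) := by gcongr
      _ = (q / 2 * K * T) ^ 5 / 120 * 25000000000 / c := by
          rw [f5]
          field_simp
  have hx : 20 * q * n * Λ * |t| ≤ 20 * q * K * T * (n : ℝ) ^ 2 := by
    calc 20 * q * n * Λ * |t| ≤ 20 * q * n * K * (T * n) := by gcongr
      _ = 20 * q * K * T * (n : ℝ) ^ 2 := by ring
  have e2 : 2 * ((20 * q * n * Λ * t) ^ 6 / ((Nat.factorial 6 : ℝ) * r ^ 5))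
      * Real.exp (20 * q * n * Λ * |t| / r)
      ≤ 2 * ((20 * q * K * T) ^ 6 / 720) * Real.exp (20 * q * K * T) / c := by
    have h6 : (20 * q * n * Λ * t) ^ 6 = (20 * q * n * Λ * |t|) ^ 6 := by
      rw [mul_pow, mul_pow _ |t|, Even.pow_abs (by decide)]
    have hexp : 20 * q * n * Λ * |t| / r ≤ 20 * q * K * T := by
      rw [div_le_iff₀ hr0]
      exact hx.trans (by gcongr)
    rw [h6]
    calc 2 * ((20 * q * n * Λ * |t|) ^ 6 / ((Nat.factorial 6 : ℝ) * r ^ 5))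
        * Real.exp (20 * q * n * Λ * |t| / r)
        ≤ 2 * ((20 * q * K * T * (n : ℝ) ^ 2) ^ 6
          / ((Nat.factorial 6 : ℝ) * (c * (n : ℝ) ^ 12))) * Real.exp (20 * q * K * T) := by
          gcongr
      _ = 2 * ((20 * q * K * T) ^ 6 / 720) * Real.exp (20 * q * K * T) / c := by
          rw [f6]
          field_simp
  rw [add_div]
  exact add_le_add e1 e2

end HeisenbergPF

theorem mainTheorem1 :
    -- the error bound for the fourth-order formula with `r` segments
    (∀ (n : ℕ), 3 ≤ n → ∀ (h : Fin n → ℝ) (t : ℝ) (r : ℕ), 1 ≤ r →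
      ‖NormedSpace.exp ((-(Complex.I * t)) • HeisenbergPF.hamiltonian h)
          - HeisenbergPF.S4 (HeisenbergPF.terms h) (-(Complex.I * t) / r) ^ r‖
        ≤ ((4 * HeisenbergPF.suzukiP - 1) / 2 * HeisenbergPF.maxNorm (HeisenbergPF.terms h) * |t|) ^ 5
              * (1 / ((Nat.factorial 5 : ℝ) * (r : ℝ) ^ 4)) * HeisenbergPF.T4 n
          + 2 * ((20 * (4 * HeisenbergPF.suzukiP - 1) * n
                  * HeisenbergPF.maxNorm (HeisenbergPF.terms h) * t) ^ 6
                / ((Nat.factorial 6 : ℝ) * (r : ℝ) ^ 5))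
              * Real.exp (20 * (4 * HeisenbergPF.suzukiP - 1) * n
                  * HeisenbergPF.maxNorm (HeisenbergPF.terms h) * |t| / r)) ∧
    -- the gate complexity `O(n^{3.4})` for bounded fields, time `O(n)` and constant accuracy
    (∀ (hmax τ ε : ℝ), 0 < ε →
      ∃ C : ℝ, ∀ (n : ℕ), 3 ≤ n →
        ∃ r : ℕ, 1 ≤ r ∧ (r : ℝ) ≤ C * (n : ℝ) ^ (12 / 5 : ℝ) ∧
          ∀ (h : Fin n → ℝ), (∀ j, |h j| ≤ hmax) → ∀ (t : ℝ), |t| ≤ τ * n →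
            ‖NormedSpace.exp ((-(Complex.I * t)) • HeisenbergPF.hamiltonian h)
                - HeisenbergPF.S4 (HeisenbergPF.terms h) (-(Complex.I * t) / r) ^ r‖ ≤ ε ∧
            ∃ g : List (HeisenbergPF.Gate n),
              HeisenbergPF.circuitOp g
                = HeisenbergPF.S4 (HeisenbergPF.terms h) (-(Complex.I * t) / r) ^ r ∧
              (g.length : ℝ) ≤ C * (n : ℝ) ^ (17 / 5 : ℝ)) := by
  open HeisenbergPF in
  refine ⟨fun n hn h t r hr => norm_exp_sub_S4_pow_le hn h t hr, fun hmax τ ε hε => ?_⟩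
  -- The couplings have norm at most 1, so `K` bounds `Λ`; the absolute values of `hmax` and `τ`
  -- cover negative inputs.
  set K := max 1 |hmax| with hK
  set M := ((4 * suzukiP - 1) / 2 * K * |τ|) ^ 5 / 120 * 25000000000
    + 2 * ((20 * (4 * suzukiP - 1) * K * |τ|) ^ 6 / 720)
      * Real.exp (20 * (4 * suzukiP - 1) * K * |τ|) with hM
  -- The error is at most `M / c`, hence at most `ε`.
  set c := max 1 (M / ε) with hc
  have hc1 : 1 ≤ c := le_max_left _ _
  -- Rounding `c n^(12/5)` up costs at most one more `n^(12/5)`; the factor 600 is the gate count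
  -- per site and segment.
  refine ⟨600 * (c + 1), fun n hn => ?_⟩
  have hn1 : (1 : ℝ) ≤ n := by exact_mod_cast (by omega : 1 ≤ n)
  have hy1 : 1 ≤ (n : ℝ) ^ (12 / 5 : ℝ) := Real.one_le_rpow hn1 (by norm_num)
  have hcy : 1 ≤ c * (n : ℝ) ^ (12 / 5 : ℝ) := one_le_mul_of_one_le_of_one_le hc1 hy1
  have hr_ge := Nat.le_ceil (c * (n : ℝ) ^ (12 / 5 : ℝ))
  have hr_le : (⌈c * (n : ℝ) ^ (12 / 5 : ℝ)⌉₊ : ℝ) ≤ (c + 1) * (n : ℝ) ^ (12 / 5 : ℝ) := by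
    have := (Nat.ceil_lt_add_one (zero_le_one.trans hcy)).le
    linarith
  set r := ⌈c * (n : ℝ) ^ (12 / 5 : ℝ)⌉₊ with hr
  have hr1 : 1 ≤ r := by exact_mod_cast hcy.trans hr_ge
  refine ⟨r, hr1, hr_le.trans ?_, fun h hh t ht => ⟨?_, ?_⟩⟩
  · gcongr
    linarith
  · have hΛ : maxNorm (terms h) ≤ K := maxNorm_terms_le (le_max_left _ _) fun j =>
      (hh j).trans ((le_abs_self _).trans (le_max_right _ _))
    have ht' : |t| ≤ |τ| * n := ht.trans (by gcongr; exact le_abs_self τ)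
    refine (norm_exp_sub_S4_pow_le hn h t hr1).trans ((error_bound_le hn hc1 (maxNorm_nonneg _)
      hΛ (abs_nonneg τ) ht' hr_ge).trans ?_)
    rw [← hM, div_le_iff₀ (by linarith), ← div_le_iff₀' hε]
    exact le_max_right _ _
  · have e : -(Complex.I * t) / r = -(Complex.I * ((t / r : ℝ) : ℂ)) := by
      push_cast
      ring
    obtain ⟨g, hg, hlen⟩ := (hasCircuit_S4 (by omega) h (t / r)).pow r
    refine ⟨g, by rw [hg, e], ?_⟩
    have hpow : (n : ℝ) ^ (17 / 5 : ℝ) = (n : ℝ) ^ (12 / 5 : ℝ) * n := by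
      rw [← Real.rpow_add_one (by linarith)]
      norm_num
    have hlen' : (g.length : ℝ) ≤ r * (600 * n) := by exact_mod_cast hlen
    rw [hpow]
    calc (g.length : ℝ) ≤ r * (600 * n) := hlen'
      _ ≤ (c + 1) * (n : ℝ) ^ (12 / 5 : ℝ) * (600 * n) := by gcongr
      _ = 600 * (c + 1) * ((n : ℝ) ^ (12 / 5 : ℝ) * n) := by ring
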